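/- Proposition (proper-biharmonic Legendre curves of osculating order $4$). Conventions: all objects are smooth. A contact metric structure on a manifold $N^{2n+1}$ is a quadruple $(\varphi,\xi,\eta,g)$ consisting of a $(1,1)$-tensor field $\varphi$, a vector field $\xi$, a one-form $\eta$ and a Riemannian metric $g$ with $$\varphi^2=-I+\eta\otimes\xi,\quad \eta(\xi)=1,\quad g(\varphi X,\varphi Y)=g(X,Y)-\eta(X)\eta(Y),\quad g(X,\varphi Y)=d\eta(X,Y)$$ for all vector fields $X,Y$, where $d\eta(X,Y)=\tfrac12\big(X\eta(Y)-Y\eta(X)-\eta([X,Y])\big)$. It is Sasakian if $[\varphi X,\varphi Y]-\varphi[\varphi X,Y]-\varphi[X,\varphi Y]+\varphi^2[X,Y]+2\,d\eta(X,Y)\,\xi=0$ for all $X,Y$, and a Sasakian space form $N(c)$ if moreover every plane spanned by $X$ and $\varphi X$, with $X$ a unit vector orthogonal to $\xi$, has sectional curvature $c$. Let $\nabla$ be the Levi-Civita connection and $R(X,Y)=\nabla_X\nabla_Y-\nabla_Y\nabla_X-\nabla_{[X,Y]}$. Let $I\subseteq\mathbb R$ be an open interval and $\gamma:I\to N$ a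 curve parametrized by arc length, $T=\gamma'$. The curve is Legendre if $\eta(T)=0$. It is a Frenet curve of osculating order $r$ if there are orthonormal vector fields $E_1=T,E_2,\dots,E_r$ along $\gamma$ and positive functions $\kappa_1,\dots,\kappa_{r-1}$ on $I$ with $\nabla_TE_1=\kappa_1E_2$, $\nabla_TE_i=-\kappa_{i-1}E_{i-1}+\kappa_iE_{i+1}$ for $1<i<r$, and $\nabla_TE_r=-\kappa_{r-1}E_{r-1}$ (for $r=1$: $\nabla_TE_1=0$). It is proper-biharmonic if $\nabla_T^3T-R(T,\nabla_TT)T=0$ on $I$ while $\nabla_TT$ does not vanish identically. The $\varphi$-torsions of a Legendre Frenet curve are $\tau_{ij}=g(E_i,\varphi E_j)$, $i<j$. Statement: Let $\gamma:I\to N(c)$ be a proper-biharmonic Legendre Frenet curve of osculating order $4$ in a Sasakian space form $N(c)$ of dimension $2n+1$. Then $c\in(\tfrac73,5)$, and the curvatures of $\gamma$ are the constants $$\kappa_1=\frac{\sqrt{c+3}}2,\qquad \kappa_2=\frac12\sqrt{\frac{6(c-1)(5-c)}{c+3}},\qquad \kappa_3=\frac12\sqrt{\frac{3(c-1)(3c-7)}{c+3}}.$$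 Moreover there is a sign $\varepsilon\in\{1,-1\}$ such that, at every point of $I$, $$\tau_{12}=-\varepsilon\sqrt{\frac{2(5-c)}{c+3}},\quad \tau_{13}=0,\quad \tau_{14}=\varepsilon\sqrt{\frac{3c-7}{c+3}},$$ $$\tau_{23}=-\varepsilon\,\frac{3c-7}{\sqrt{3(c-1)(c+3)}},\quad \tau_{24}=0,\quad \tau_{34}=\varepsilon\sqrt{\frac{2(5-c)(3c-7)}{3(c-1)(c+3)}}.$$ -/

import Mathlib

open scoped Manifold ContDiff Bundle

noncomputable section

namespace SasakianCurves

section Riemannian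

/- `N` is a smooth manifold of dimension `d` without boundary.  Its Riemannian metric is the smooth
family of inner products `inner ℝ` on the fibres `TangentSpace (𝓡 d) x` which is registered by
`RiemannianBundle` and `IsContMDiffRiemannianBundle`. -/
variable {d : ℕ} {N : Type*} [TopologicalSpace N] [ChartedSpace (EuclideanSpace ℝ (Fin d)) N]
  [IsManifold (𝓡 d) ∞ N]

/-- Smooth vector fields on `N`. -/
def IsSmoothVectorField (X : ∀ x : N, TangentSpace (𝓡 d) x) : Prop :=
  ContMDiff (𝓡 d) (𝓡 d).tangent ∞ (fun x : N => (⟨x, X x⟩ : TangentBundle (𝓡 d) N))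

set_option synthInstance.maxHeartbeats 200000 in
/-- `nabla` is the Levi-Civita connection of `N`: the smooth connection on the tangent bundle that
is torsion-free and compatible with the metric.
Mathlib writes `nabla Y x u` for `(∇_u Y)(x)`. -/
structure IsLeviCivita [Bundle.RiemannianBundle (fun x : N => TangentSpace (𝓡 d) x)]
    [IsContMDiffRiemannianBundle (𝓡 d) ∞ (EuclideanSpace ℝ (Fin d))
      (fun x : N => TangentSpace (𝓡 d) x)]
    (nabla : CovariantDerivative (𝓡 d) (EuclideanSpace ℝ (Fin d))
      (fun x : N => TangentSpace (𝓡 d) x)) : Prop where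
  smooth : nabla.ContMDiffCovariantDerivative ∞
  torsion_free : nabla.torsion = 0
  metric : nabla.IsMetricCompatible

variable (nabla : CovariantDerivative (𝓡 d) (EuclideanSpace ℝ (Fin d))
  (fun x : N => TangentSpace (𝓡 d) x))

/-- `∇_X Y` for vector fields. -/
def covDeriv (X Y : ∀ x : N, TangentSpace (𝓡 d) x) (x : N) : TangentSpace (𝓡 d) x :=
  nabla Y x (X x)

/-- The curvature operator `R(X, Y)Z = ∇_X ∇_Y Z - ∇_Y ∇_X Z - ∇_[X, Y] Z` on vector fields. -/
def curvatureField (X Y Z : ∀ x : N, TangentSpace (𝓡 d) x) (x : N) : TangentSpace (𝓡 d) x :=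
  covDeriv nabla X (covDeriv nabla Y Z) x - covDeriv nabla Y (covDeriv nabla X Z) x
    - covDeriv nabla (VectorField.mlieBracket (𝓡 d) X Y) Z x

/-- The curvature tensor `R(u, v)w` at the point `x`, computed by extending the tangent vectors
`u`, `v`, `w` to vector fields that are smooth near `x` (by tensoriality, the choice of the
extension does not matter). -/
def curvature (x : N) (u v w : TangentSpace (𝓡 d) x) : TangentSpace (𝓡 d) x :=
  curvatureField nabla (FiberBundle.extend (EuclideanSpace ℝ (Fin d)) u)
    (FiberBundle.extend (EuclideanSpace ℝ (Fin d)) v)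
    (FiberBundle.extend (EuclideanSpace ℝ (Fin d)) w) x

/-- The sectional curvature of the plane spanned by linearly independent `u`, `v`. -/
def sectionalCurvature [Bundle.RiemannianBundle (fun x : N => TangentSpace (𝓡 d) x)]
    (x : N) (u v : TangentSpace (𝓡 d) x) : ℝ :=
  inner ℝ (curvature nabla x u v v) u /
    (inner ℝ u u * inner ℝ v v - inner ℝ u v ^ 2)

/-! ### Curves -/

/-- The velocity `T = γ'` of a curve. -/
def velocity (γ : ℝ → N) (s : ℝ) : TangentSpace (𝓡 d) (γ s) :=
  mfderiv 𝓘(ℝ, ℝ) (𝓡 d) γ s (1 : ℝ)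

/-- `V` is a smooth vector field along `γ` on the (open) set `J`. -/
def IsSmoothAlong (γ : ℝ → N) (J : Set ℝ) (V : ∀ s, TangentSpace (𝓡 d) (γ s)) : Prop :=
  ContMDiffOn 𝓘(ℝ, ℝ) (𝓡 d).tangent ∞ (fun s => (⟨γ s, V s⟩ : TangentBundle (𝓡 d) N)) J

/-- The covariant derivative `∇_T V` at `s` of a vector field `V` along the curve `γ`.
Near `γ s` write `V = ∑ vⁱ ∂ᵢ` in the coordinate frame `∂ᵢ` of the chart at `γ s`; then
`∇_T V = ∑ (vⁱ)' ∂ᵢ + ∑ vⁱ ∇_{γ'} ∂ᵢ`.  In the second sum the coefficients are frozen at `s`, and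
the field with these constant coefficients in the frame `∂ᵢ` is `FiberBundle.extend _ (V s)`. -/
def covDerivAlong (γ : ℝ → N) (V : ∀ s, TangentSpace (𝓡 d) (γ s)) (s : ℝ) :
    TangentSpace (𝓡 d) (γ s) :=
  (trivializationAt (EuclideanSpace ℝ (Fin d)) (fun x : N => TangentSpace (𝓡 d) x) (γ s)).symm (γ s)
      (deriv (fun t => (trivializationAt (EuclideanSpace ℝ (Fin d))
        (fun x : N => TangentSpace (𝓡 d) x) (γ s) ⟨γ t, V t⟩).2) s)
    + nabla (FiberBundle.extend (EuclideanSpace ℝ (Fin d)) (V s)) (γ s) (velocity γ s)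

/-- The tension field `τ(γ) = ∇_T T`. -/
def tension (γ : ℝ → N) : ∀ s, TangentSpace (𝓡 d) (γ s) :=
  covDerivAlong nabla γ (velocity γ)

/-- The bitension field `τ₂(γ) = ∇_T ∇_T τ(γ) - R(T, τ(γ))T`. -/
def bitension (γ : ℝ → N) (s : ℝ) : TangentSpace (𝓡 d) (γ s) :=
  covDerivAlong nabla γ (covDerivAlong nabla γ (tension nabla γ)) s
    - curvature nabla (γ s) (velocity γ s) (tension nabla γ s) (velocity γ s)

/-- `γ` is harmonic on `J`. -/
def IsHarmonicOn (γ : ℝ → N) (J : Set ℝ) : Prop := ∀ s ∈ J, tension nabla γ s = 0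

/-- `γ` is biharmonic on `J`. -/
def IsBiharmonicOn (γ : ℝ → N) (J : Set ℝ) : Prop := ∀ s ∈ J, bitension nabla γ s = 0

/-- `γ` is proper-biharmonic on `J`: biharmonic and not harmonic. -/
def IsProperBiharmonicOn (γ : ℝ → N) (J : Set ℝ) : Prop :=
  IsBiharmonicOn nabla γ J ∧ ¬ IsHarmonicOn nabla γ J

/-- `γ : J → N` is a Frenet curve of osculating order `r` with Frenet frame `E 1, …, E r` and
curvatures `κ 1, …, κ (r - 1)`.  (Values of `E` and `κ` at other indices play no role.) -/
structure IsFrenetCurve [Bundle.RiemannianBundle (fun x : N => TangentSpace (𝓡 d) x)]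
    (γ : ℝ → N) (J : Set ℝ) (r : ℕ) (E : ℕ → ∀ s, TangentSpace (𝓡 d) (γ s))
    (κ : ℕ → ℝ → ℝ) : Prop where
  one_le_order : 1 ≤ r
  smooth_curve : ContMDiffOn 𝓘(ℝ, ℝ) (𝓡 d) ∞ γ J
  smooth_frame : ∀ i ∈ Finset.Icc 1 r, IsSmoothAlong γ J (E i)
  orthonormal : ∀ s ∈ J, ∀ i ∈ Finset.Icc 1 r, ∀ j ∈ Finset.Icc 1 r,
    inner ℝ (E i s) (E j s) = if i = j then (1 : ℝ) else 0
  frame_one : ∀ s ∈ J, E 1 s = velocity γ s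
  smooth_curvature : ∀ i ∈ Finset.Ico 1 r, ContDiffOn ℝ ∞ (κ i) J
  curvature_pos : ∀ i ∈ Finset.Ico 1 r, ∀ s ∈ J, 0 < κ i s
  frenet : ∀ s ∈ J, ∀ i ∈ Finset.Icc 1 r, covDerivAlong nabla γ (E i) s =
    (if 1 < i then -(κ (i - 1) s) • E (i - 1) s else 0) + (if i < r then κ i s • E (i + 1) s else 0)

end Riemannian

section Sasakian

variable (n : ℕ) (N : Type*) [TopologicalSpace N]
  [ChartedSpace (EuclideanSpace ℝ (Fin (2 * n + 1))) N] [IsManifold (𝓡 (2 * n + 1)) ∞ N]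
  [Bundle.RiemannianBundle (fun x : N => TangentSpace (𝓡 (2 * n + 1)) x)]

variable {n N} in
/-- The exterior derivative of a one-form on vector fields, normalised by the factor `1 / 2` as is
customary in contact metric geometry: `dη(X, Y) = (X(η(Y)) - Y(η(X)) - η([X, Y])) / 2`. -/
def extDerivOneForm (η : ∀ x : N, TangentSpace (𝓡 (2 * n + 1)) x →L[ℝ] ℝ)
    (X Y : ∀ x : N, TangentSpace (𝓡 (2 * n + 1)) x) (x : N) : ℝ :=
  (mvfderiv (𝓡 (2 * n + 1)) (fun y => η y (Y y)) x (X x)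
    - mvfderiv (𝓡 (2 * n + 1)) (fun y => η y (X y)) x (Y x)
    - η x (VectorField.mlieBracket (𝓡 (2 * n + 1)) X Y x)) / 2

/-- A contact metric structure `(φ, ξ, η, g)` on `N`, where `g` is the given Riemannian metric. -/
structure ContactMetricStructure where
  φ : ∀ x : N, TangentSpace (𝓡 (2 * n + 1)) x →L[ℝ] TangentSpace (𝓡 (2 * n + 1)) x
  ξ : ∀ x : N, TangentSpace (𝓡 (2 * n + 1)) x
  η : ∀ x : N, TangentSpace (𝓡 (2 * n + 1)) x →L[ℝ] ℝ
  smooth_φ : ContMDiff (𝓡 (2 * n + 1)) ((𝓡 (2 * n + 1)).prod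
    𝓘(ℝ, EuclideanSpace ℝ (Fin (2 * n + 1)) →L[ℝ] EuclideanSpace ℝ (Fin (2 * n + 1)))) ∞
    (fun x => Bundle.TotalSpace.mk'
      (EuclideanSpace ℝ (Fin (2 * n + 1)) →L[ℝ] EuclideanSpace ℝ (Fin (2 * n + 1)))
      (E := fun x : N => TangentSpace (𝓡 (2 * n + 1)) x →L[ℝ] TangentSpace (𝓡 (2 * n + 1)) x)
      x (φ x))
  smooth_ξ : IsSmoothVectorField ξ
  smooth_η : ContMDiff (𝓡 (2 * n + 1)) ((𝓡 (2 * n + 1)).prod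
    𝓘(ℝ, EuclideanSpace ℝ (Fin (2 * n + 1)) →L[ℝ] ℝ)) ∞
    (fun x => Bundle.TotalSpace.mk' (EuclideanSpace ℝ (Fin (2 * n + 1)) →L[ℝ] ℝ)
      (E := fun x : N => TangentSpace (𝓡 (2 * n + 1)) x →L[ℝ] Bundle.Trivial N ℝ x) x (η x))
  φ_sq : ∀ x (u : TangentSpace (𝓡 (2 * n + 1)) x), φ x (φ x u) = -u + η x u • ξ x
  η_ξ : ∀ x, η x (ξ x) = 1
  inner_φ_φ : ∀ x (u v : TangentSpace (𝓡 (2 * n + 1)) x),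
    inner ℝ (φ x u) (φ x v) = inner ℝ u v - η x u * η x v
  inner_φ : ∀ X Y : (∀ x : N, TangentSpace (𝓡 (2 * n + 1)) x),
    IsSmoothVectorField X → IsSmoothVectorField Y →
    ∀ x, inner ℝ (X x) (φ x (Y x)) = extDerivOneForm η X Y x

variable {n N}

/-- The action of `φ` on vector fields. -/
def ContactMetricStructure.φField (S : ContactMetricStructure n N)
    (X : ∀ x : N, TangentSpace (𝓡 (2 * n + 1)) x) (x : N) : TangentSpace (𝓡 (2 * n + 1)) x :=
  S.φ x (X x)

/-- The Nijenhuis tensor `N_φ(X, Y) = [φX, φY] - φ[φX, Y] - φ[X, φY] + φ²[X, Y]`. -/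
def ContactMetricStructure.nijenhuis (S : ContactMetricStructure n N)
    (X Y : ∀ x : N, TangentSpace (𝓡 (2 * n + 1)) x) (x : N) : TangentSpace (𝓡 (2 * n + 1)) x :=
  VectorField.mlieBracket (𝓡 (2 * n + 1)) (S.φField X) (S.φField Y) x
    - S.φ x (VectorField.mlieBracket (𝓡 (2 * n + 1)) (S.φField X) Y x)
    - S.φ x (VectorField.mlieBracket (𝓡 (2 * n + 1)) X (S.φField Y) x)
    + S.φ x (S.φ x (VectorField.mlieBracket (𝓡 (2 * n + 1)) X Y x))

/-- A contact metric structure is Sasakian if it is normal: `N_φ + 2 dη ⊗ ξ = 0`. -/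
def ContactMetricStructure.IsSasakian (S : ContactMetricStructure n N) : Prop :=
  ∀ X Y : (∀ x : N, TangentSpace (𝓡 (2 * n + 1)) x),
    IsSmoothVectorField X → IsSmoothVectorField Y →
    ∀ x, S.nijenhuis X Y x + (2 * extDerivOneForm S.η X Y x) • S.ξ x = 0

/-- `(N, φ, ξ, η, g)` is a Sasakian space form `N(c)`: it is Sasakian and for each unit vector `u`
orthogonal to `ξ` the plane spanned by `u` and `φu` has sectional curvature `c`. -/
def ContactMetricStructure.IsSasakianSpaceForm (S : ContactMetricStructure n N)
    (nabla : CovariantDerivative (𝓡 (2 * n + 1)) (EuclideanSpace ℝ (Fin (2 * n + 1)))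
      (fun x : N => TangentSpace (𝓡 (2 * n + 1)) x)) (c : ℝ) : Prop :=
  S.IsSasakian ∧ ∀ (x : N) (u : TangentSpace (𝓡 (2 * n + 1)) x),
    inner ℝ u u = (1 : ℝ) → inner ℝ u (S.ξ x) = (0 : ℝ) →
    sectionalCurvature nabla x u (S.φ x u) = c

/-- `γ` is a Legendre curve on `J`: an integral curve of the contact distribution `ker η`. -/
def ContactMetricStructure.IsLegendreOn (S : ContactMetricStructure n N) (γ : ℝ → N)
    (J : Set ℝ) : Prop :=
  ∀ s ∈ J, S.η (γ s) (velocity γ s) = 0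

/-- The `φ`-torsion `τᵢⱼ = g(Eᵢ, φEⱼ)` of a frame `E` along `γ`. -/
def ContactMetricStructure.φTorsion (S : ContactMetricStructure n N) (γ : ℝ → N)
    (E : ℕ → ∀ s, TangentSpace (𝓡 (2 * n + 1)) (γ s)) (i j : ℕ) (s : ℝ) : ℝ :=
  inner ℝ (E i s) (S.φ (γ s) (E j s))

end Sasakian

end SasakianCurves

end

open SasakianCurves

noncomputable section

open scoped Topology
open Bundle

namespace SasakianCurves

/-! Normality of the contact metric structure forces $\nabla_X\xi=-\varphi X$ and
$(\nabla_X\varphi)Y=g(X,Y)\xi-\eta(Y)X$ (`covDeriv_ξ`, `covDerivφ_eq`). These fix $R(X,Y)\xi$ and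
the commutator of $R(X,Y)$ with $\varphi$. Constant $\varphi$-sectional curvature then determines
$R(u,v)u$ for horizontal $u,v$ by Kähler-type polarisation (`IsSasakianSpaceForm.curvature_eq`).

Put $f_i=g(E_i,\varphi T)$. Differentiating $\eta(T)=0$ gives $\eta(E_2)=0$, so the curvature
formula applies to $R(T,\kappa_1E_2)T$, and the bitension field is a combination of $E_1,\dots,E_4$
and $\varphi T$ (`bitension_eq`). Its vanishing says that $\kappa_1$ is constant, that
$\kappa_1^2+\kappa_2^2=\frac{c+3}4+\frac{3(c-1)}4f_2^2$, $\kappa_2'=-\frac{3(c-1)}4f_2f_3$ and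
$\kappa_2\kappa_3=-\frac{3(c-1)}4f_2f_4$, and that $\varphi T=f_2E_2+f_3E_3+f_4E_4$
(`frame_relations_of_biharmonic`).

Since $f_2'=\kappa_2f_3$, differentiating the first of these relations contradicts the second unless
$f_3=0$ (`inner_frame_three_φ`). Hence $f_2$, $f_4$ and $\kappa_2$ are locally constant.
Differentiating $\eta(E_i)$ along the frame gives $\eta(E_4)=0$, $\kappa_2\eta(E_3)=f_2$ and
$\kappa_3\eta(E_3)=-f_4$. Differentiating $\varphi T=f_2E_2+f_4E_4$ gives a vector identity for
$\kappa_1\varphi E_2+\xi$ (`frame_derivative_φ_frame_one`), whose norm and components, with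
$\varphi^2T=-T$, supply the remaining equations. The resulting polynomial system determines
everything up to one sign (`closed_forms_of_relations`); that sign is global because $\tau_{12}$ is
constant and nonzero on the interval. -/

/-! ### Pointwise algebra of curvature-like forms. -/

/-- A curvature-like `4`-form that is invariant under a complex structure `φ` vanishes on
`(u, v, u, w)` if its holomorphic sectional curvature vanishes. -/
theorem curvatureLike_eq_zero {V : Type*} [AddCommGroup V] {φ : V → V} {D : V → V → V → V → ℝ}
    (hadd : ∀ x x' y z w, D (x + x') y z w = D x y z w + D x' y z w)
    (hφ : ∀ x y, φ (x + y) = φ x + φ y)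
    (hanti : ∀ x y z w, D x y z w = -D y x z w)
    (hpair : ∀ x y z w, D x y z w = D z w x y)
    (hbianchi : ∀ x y z w, D x y z w + D y z x w + D z x y w = 0)
    (hinv : ∀ x y z w, D x y (φ z) (φ w) = D x y z w)
    (hsq : ∀ x y z w, D (φ (φ x)) y z w = -D x y z w)
    (hhol : ∀ x, D x (φ x) (φ x) x = 0) (x y w : V) : D x y x w = 0 := by
  have hinv' : ∀ x y z w, D (φ x) (φ y) z w = D x y z w := fun x y z w => by
    rw [hpair, hinv, hpair]
  have hsq2 : ∀ x y z w, D x (φ (φ y)) z w = -D x y z w := fun x y z w => by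
    rw [hanti, hsq, hanti x y]
  have hadd2 : ∀ x y y' z w, D x (y + y') z w = D x y z w + D x y' z w := fun x y y' z w => by
    rw [hanti, hadd, hanti x y, hanti x y']; ring
  have hadd3 : ∀ x y z z' w, D x y (z + z') w = D x y z w + D x y z' w := fun x y z z' w => by
    rw [hpair, hadd, hpair x y z, hpair x y z']
  have hadd4 : ∀ x y z w w', D x y z (w + w') = D x y z w + D x y z w' := fun x y z w w' => by
    rw [hpair, hadd2, hpair x y z w, hpair x y z w']
  have hanti2 : ∀ x y z w, D x y z w = -D x y w z := fun x y z w => by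
    rw [hpair, hanti, hpair x y w z]
  have hneg : ∀ x y z w, D (-x) y z w = -D x y z w := fun x y z w => by
    have h0 : D 0 y z w = 0 := by simpa using hadd 0 0 y z w
    have := hadd x (-x) y z w
    rw [add_neg_cancel, h0] at this
    linarith
  have hφneg : ∀ x, φ (-x) = -φ x := fun x => by
    have h0 : φ 0 = 0 := by simpa using hφ 0 0
    have := hφ x (-x)
    rw [add_neg_cancel, h0] at this
    exact (neg_eq_of_add_eq_zero_right this.symm).symm
  have hneg2 : ∀ x y z w, D x (-y) z w = -D x y z w := fun x y z w => by
    rw [hanti, hneg, hanti x y]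
  have hneg3 : ∀ x y z w, D x y (-z) w = -D x y z w := fun x y z w => by
    rw [hpair, hneg, hpair x y z w]
  have hneg4 : ∀ x y z w, D x y z (-w) = -D x y z w := fun x y z w => by
    rw [hpair, hneg2, hpair x y z w]
  have hsymm : ∀ x y z w, D x (φ y) z w = D y (φ x) z w := fun x y z w => by
    rw [← hinv', hsq2, hanti (φ x)]; ring
  -- Adding the holomorphic identities for `x + y` and `x - y` keeps the terms of degree two in `y`;
  -- the Bianchi identity then removes `D x (φ x) y (φ y)`.
  have key : ∀ x y, D x y x y + 3 * D x (φ y) x (φ y) = 0 := by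
    intro x y
    have hhol' : ∀ x, D x (φ x) x (φ x) = 0 := fun x => by rw [hanti2, hhol, neg_zero]
    have h1 := hhol' (x + y)
    have h2 := hhol' (x + -y)
    simp only [hφ, hφneg, hadd, hadd2, hadd3, hadd4, hneg, hneg2, hneg3, hneg4, hhol'] at h1 h2
    have e1 := hbianchi x (φ x) y (φ y)
    have e2 : D (φ x) y x (φ y) = -D x (φ y) x (φ y) := by rw [hanti, hsymm]
    have e3 : D y x (φ x) (φ y) = -D x y x y := by rw [hinv, hanti]
    rw [e2, e3] at e1
    have s1 : D y (φ y) x (φ x) = D x (φ x) y (φ y) := hpair ..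
    have s2 : ∀ z w, D z w y (φ x) = D z w x (φ y) := fun z w => by
      rw [hpair, hsymm, hpair]
    simp only [s1, s2, hsymm y x] at h1 h2
    linarith
  have key2 : ∀ x y, D x y x y = 0 := by
    intro x y
    have h1 := key x y
    -- Replacing `y` by `φ y` swaps the two terms, so the coefficients 1 and 3 change places and
    -- both terms vanish.
    have h2 := key x (φ y)
    rw [hsq2, hpair x y, hsq2] at h2
    linarith
  have := key2 x (y + w)
  simp only [hadd2, hadd4, key2] at this
  have e : D x w x y = D x y x w := hpair ..
  linarith

/-- A curvature-like `4`-form satisfying the Sasakian curvature identities and with constant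
`φ`-sectional curvature `c` is that of the Sasakian space form, on arguments `(u, v, u, w)`. -/
theorem sasakianSpaceForm_curvature_algebra {V : Type*} [NormedAddCommGroup V]
    [InnerProductSpace ℝ V] (φ : V →ₗ[ℝ] V) (ξ : V) (c : ℝ) (R : V → V → V → V → ℝ)
    (hadd : ∀ x x' y z w, R (x + x') y z w = R x y z w + R x' y z w)
    (hsmul : ∀ (a : ℝ) x y z w, R (a • x) y z w = a * R x y z w)
    (hanti : ∀ x y z w, R x y z w = -R y x z w)
    (hpair : ∀ x y z w, R x y z w = R z w x y)
    (hbianchi : ∀ x y z w, R x y z w + R y z x w + R z x y w = 0)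
    (hφ_sq : ∀ u, φ (φ u) = -u + (inner ℝ u ξ : ℝ) • ξ)
    (hφ_anti : ∀ u v, (inner ℝ (φ u) v : ℝ) = -inner ℝ u (φ v))
    (hξ : (inner ℝ ξ ξ : ℝ) = 1) (hφξ : φ ξ = 0)
    (hRξ : ∀ x y w, R x y ξ w = inner ℝ y ξ * inner ℝ x w - inner ℝ x ξ * inner ℝ y w)
    (hRφ : ∀ x y z w, R x y (φ z) w = -R x y z (φ w) - inner ℝ y z * inner ℝ (φ x) w
      + inner ℝ z (φ x) * inner ℝ y w + inner ℝ x z * inner ℝ (φ y) w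
      - inner ℝ z (φ y) * inner ℝ x w)
    (hsec : ∀ u, (inner ℝ u u : ℝ) = 1 → (inner ℝ u ξ : ℝ) = 0 → R u (φ u) (φ u) u = c)
    (u v w : V) (hu : (inner ℝ u ξ : ℝ) = 0) (hv : (inner ℝ v ξ : ℝ) = 0) :
    R u v u w = (c + 3) / 4 * (inner ℝ u v * inner ℝ u w - inner ℝ u u * inner ℝ v w)
      + 3 * (c - 1) / 4 * (inner ℝ u (φ v) * inner ℝ (φ u) w) := by
  -- `K` is the full curvature tensor of the model. The defect `R - K` vanishes when a slot is `ξ`,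
  -- so `φ` acts on it like a complex structure although $\varphi^2\ne-1$.
  set K : V → V → V → V → ℝ := fun x y z w =>
    (c + 3) / 4 * (inner ℝ y z * inner ℝ x w - inner ℝ x z * inner ℝ y w)
      + (c - 1) / 4 * (inner ℝ x ξ * inner ℝ z ξ * inner ℝ y w
        - inner ℝ y ξ * inner ℝ z ξ * inner ℝ x w
        + inner ℝ x z * inner ℝ y ξ * inner ℝ w ξ - inner ℝ y z * inner ℝ x ξ * inner ℝ w ξ
        + inner ℝ z (φ y) * inner ℝ (φ x) w - inner ℝ z (φ x) * inner ℝ (φ y) w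
        + 2 * inner ℝ x (φ y) * inner ℝ (φ z) w) with hK
  have hφφ : ∀ u, (inner ℝ u (φ u) : ℝ) = 0 := fun u => by
    have := hφ_anti u u
    rw [real_inner_comm] at this
    linarith
  have hφη : ∀ u, (inner ℝ (φ u) ξ : ℝ) = 0 := fun u => by rw [hφ_anti, hφξ]; simp
  have hφη' : ∀ u, (inner ℝ ξ (φ u) : ℝ) = 0 := fun u => by rw [real_inner_comm, hφη]
  set D : V → V → V → V → ℝ := fun x y z w => R x y z w - K x y z w with hD
  have Danti : ∀ x y z w, D x y z w = -D y x z w := fun x y z w => by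
    simp only [hD, hK]
    rw [hanti x y, ← neg_eq_iff_eq_neg.mpr (hφ_anti x y), real_inner_comm y (φ x)]
    ring
  have Dpair : ∀ x y z w, D x y z w = D z w x y := fun x y z w => by
    simp only [hD, hK]
    rw [hpair x y]
    simp only [hφ_anti, real_inner_comm w y, real_inner_comm z x, real_inner_comm w x,
      real_inner_comm y z]
    have h1 := hφ_anti w x
    have h2 := hφ_anti w y
    have h3 := hφ_anti x z
    have h4 := hφ_anti y z
    rw [real_inner_comm] at h1 h2 h3 h4
    rw [h1, h2, h3, h4]
    ring
  have Dbianchi : ∀ x y z w, D x y z w + D y z x w + D z x y w = 0 := fun x y z w => by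
    simp only [hD, hK]
    have h := hbianchi x y z w
    have h1 := hφ_anti x y
    have h2 := hφ_anti y z
    have h3 := hφ_anti x z
    rw [real_inner_comm] at h1 h2 h3
    rw [h1, h2, h3, real_inner_comm x y, real_inner_comm x z, real_inner_comm y z]
    linear_combination h
  have Dξ : ∀ x y w, D x y ξ w = 0 := fun x y w => by
    simp only [hD, hK, hRξ, hξ, hφη', hφξ, inner_zero_left]
    ring
  have Dξ4 : ∀ x y z, D x y z ξ = 0 := fun x y z => by
    rw [Dpair, Danti, Dpair, Dξ, neg_zero]
  have Dadd : ∀ x x' y z w, D (x + x') y z w = D x y z w + D x' y z w := fun x x' y z w => by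
    simp only [hD, hK, hadd, map_add, inner_add_left, inner_add_right]
    ring
  have Dsmul : ∀ (a : ℝ) x y z w, D (a • x) y z w = a * D x y z w := fun a x y z w => by
    simp only [hD, hK, hsmul, map_smul, real_inner_smul_left, real_inner_smul_right]
    ring
  have Dadd2 : ∀ x y y' z w, D x (y + y') z w = D x y z w + D x y' z w := fun x y y' z w => by
    rw [Danti, Dadd, Danti x y, Danti x y']; ring
  have Dsmul2 : ∀ (a : ℝ) x y z w, D x (a • y) z w = a * D x y z w := fun a x y z w => by
    rw [Danti, Dsmul, Danti x y]; ring
  have Dadd3 : ∀ x y z z' w, D x y (z + z') w = D x y z w + D x y z' w := fun x y z z' w => by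
    rw [Dpair, Dadd, Dpair x y z, Dpair x y z']
  have Dsmul3 : ∀ (a : ℝ) x y z w, D x y (a • z) w = a * D x y z w := fun a x y z w => by
    rw [Dpair, Dsmul, Dpair x y]
  have Dadd4 : ∀ x y z w w', D x y z (w + w') = D x y z w + D x y z w' := fun x y z w w' => by
    rw [Dpair, Dadd2, Dpair x y z w, Dpair x y z w']
  have Dsmul4 : ∀ (a : ℝ) x y z w, D x y z (a • w) = a * D x y z w := fun a x y z w => by
    rw [Dpair, Dsmul2, Dpair x y]
  have Dφ : ∀ x y z w, D x y (φ z) w = -D x y z (φ w) := fun x y z w => by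
    simp only [hD, hK, hRφ, hφη, hφ_sq, inner_add_left, inner_neg_left, real_inner_smul_left]
    simp only [hφ_anti, hφ_sq, inner_add_right, inner_neg_right, real_inner_smul_right]
    have h1 := hφ_anti y z
    have h2 := hφ_anti x z
    rw [real_inner_comm] at h1 h2
    rw [h1, h2, real_inner_comm y z, real_inner_comm x z, real_inner_comm w ξ]
    ring
  have Dsq4 : ∀ x y z w, D x y z (φ (φ w)) = -D x y z w := fun x y z w => by
    have h := Dsmul4 (-1) x y z w
    rw [neg_one_smul] at h
    rw [hφ_sq, Dadd4, Dsmul4, Dξ4, h]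
    ring
  have Dinv : ∀ x y z w, D x y (φ z) (φ w) = D x y z w := fun x y z w => by
    rw [Dφ, Dsq4, neg_neg]
  have Dsq : ∀ x y z w, D (φ (φ x)) y z w = -D x y z w := fun x y z w => by
    rw [Danti, Dpair, Dsq4, Dpair, neg_neg, Danti]
  have Dhol_unit : ∀ x, (inner ℝ x x : ℝ) = 1 → (inner ℝ x ξ : ℝ) = 0 → D x (φ x) (φ x) x = 0 := by
    intro x h1 h2
    have h3 : (inner ℝ (φ x) (φ x) : ℝ) = 1 := by
      rw [hφ_anti, hφ_sq, inner_add_right, inner_neg_right, h1, h2]; simp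
    have h4 : (inner ℝ (φ x) x : ℝ) = 0 := by rw [real_inner_comm, hφφ]
    simp only [hD, hK, hsec x h1 h2, h4, h1, h2, h3, hφη, hφφ, hφ_sq, inner_add_right,
      inner_neg_right,
      inner_add_left, inner_neg_left, real_inner_smul_right, real_inner_smul_left]
    ring
  have Dhol : ∀ x, D x (φ x) (φ x) x = 0 := by
    intro x
    -- `y` is minus the horizontal part of `x`. The defect does not see the difference, and `y`,
    -- when nonzero, can be normalised to meet the unit and orthogonality conditions of `hsec`.
    set y := φ (φ x) with hy
    have hDy : D y (φ y) (φ y) y = D x (φ x) (φ x) x := by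
      have Dsq2 : ∀ x y z w, D x (φ (φ y)) z w = -D x y z w := fun x y z w => by
        rw [Danti, Dsq, Danti x y]
      rw [hy, Dsq, Dsq4, Dsq2, Dpair, Dsq, Dpair]
      ring
    rw [← hDy]
    obtain h0 | h0 := eq_or_ne y 0
    · rw [h0]
      simpa using Dsmul 0 0 (φ 0) (φ 0) 0
    have hr : ‖y‖ ≠ 0 := norm_ne_zero_iff.mpr h0
    obtain ⟨u, hyu⟩ : ∃ u, u = (‖y‖)⁻¹ • y := ⟨_, rfl⟩
    have hyu' : y = ‖y‖ • u := by rw [hyu, smul_smul, mul_inv_cancel₀ hr, one_smul]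
    have h1 := Dhol_unit u
      (by rw [hyu, real_inner_smul_left, real_inner_smul_right, real_inner_self_eq_norm_sq]
          field_simp)
      (by rw [hyu, real_inner_smul_left, hy, hφη, mul_zero])
    generalize ‖y‖ = r at hyu'
    rw [hyu']
    simp only [map_smul, Dsmul, Dsmul2, Dsmul3, Dsmul4, h1, mul_zero]
  have := curvatureLike_eq_zero (φ := φ) (D := D) Dadd (fun x y => map_add φ x y) Danti Dpair
    Dbianchi Dinv Dsq Dhol u v w
  simp only [hD, hK, hu, hv] at this
  have h := hφφ u
  have h2 := hφ_anti u v
  rw [real_inner_comm] at h2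
  rw [h, real_inner_comm u v] at this
  linear_combination this

/-! ### Smooth vector fields and their brackets. -/

section Fields
variable {d : ℕ} {N : Type*} [TopologicalSpace N] [ChartedSpace (EuclideanSpace ℝ (Fin d)) N]
  [IsManifold (𝓡 d) ∞ N] {X Y Z W : ∀ x : N, TangentSpace (𝓡 d) x}

theorem IsSmoothVectorField.mdifferentiableAt (hX : IsSmoothVectorField X) (x : N) :
    MDifferentiableAt (𝓡 d) (𝓡 d).tangent (fun x : N => (⟨x, X x⟩ : TangentBundle (𝓡 d) N)) x :=
  (hX x).mdifferentiableAt (by simp)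

theorem IsSmoothVectorField.add (hX : IsSmoothVectorField X) (hY : IsSmoothVectorField Y) :
    IsSmoothVectorField (X + Y) :=
  ContMDiff.add_section hX hY

theorem IsSmoothVectorField.neg (hX : IsSmoothVectorField X) :
    IsSmoothVectorField (-X) :=
  ContMDiff.neg_section hX

theorem IsSmoothVectorField.sub (hX : IsSmoothVectorField X) (hY : IsSmoothVectorField Y) :
    IsSmoothVectorField (X - Y) :=
  ContMDiff.sub_section hX hY

theorem IsSmoothVectorField.smul (hX : IsSmoothVectorField X) {f : N → ℝ}
    (hf : ContMDiff (𝓡 d) 𝓘(ℝ, ℝ) ∞ f) :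
    IsSmoothVectorField (f • X) :=
  ContMDiff.smul_section hf hX

theorem isManifold_minSmoothness (k : ℕ∞) : IsManifold (𝓡 d) (minSmoothness ℝ k) N := by
  rw [minSmoothness_of_isRCLikeNormedField]
  exact IsManifold.of_le (n := ∞) (by exact_mod_cast le_top)

theorem IsSmoothVectorField.mlieBracket (hX : IsSmoothVectorField X) (hY : IsSmoothVectorField Y) :
    IsSmoothVectorField (VectorField.mlieBracket (𝓡 d) X Y) := by
  intro x
  have : IsManifold (𝓡 d) (minSmoothness ℝ 2) N := isManifold_minSmoothness 2
  have : IsManifold (𝓡 d) (((⊤ : ℕ∞) : WithTop ℕ∞) + 1) N := by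
    rw [show ((⊤ : ℕ∞) : WithTop ℕ∞) + 1 = ∞ from rfl]
    infer_instance
  exact ContMDiffAt.mlieBracket_vectorField (n := ⊤) (m := ⊤) (hX x) (hY x) (by simp)

theorem IsSmoothVectorField.mvfderiv (hX : IsSmoothVectorField X) {f : N → ℝ}
    (hf : ContMDiff (𝓡 d) 𝓘(ℝ, ℝ) ∞ f) :
    ContMDiff (𝓡 d) 𝓘(ℝ, ℝ) ∞ (fun x => mvfderiv (𝓡 d) f x (X x)) := by
  have h1 : ContMDiff (𝓡 d).tangent 𝓘(ℝ, ℝ).tangent ∞ (tangentMap (𝓡 d) 𝓘(ℝ, ℝ) f) :=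
    hf.contMDiff_tangentMap (by simp)
  have h2 := h1.comp hX
  exact contMDiff_snd_tangentBundle_modelSpace ℝ 𝓘(ℝ, ℝ) |>.comp h2

theorem contMDiffOn_extend {x : N} (v : TangentSpace (𝓡 d) x) :
    ContMDiffOn (𝓡 d) (𝓡 d).tangent ∞ (fun y : N => (⟨y, FiberBundle.extend
      (E := fun x : N => TangentSpace (𝓡 d) x) (EuclideanSpace ℝ (Fin d)) v y⟩ :
        TangentBundle (𝓡 d) N)) (chartAt (EuclideanSpace ℝ (Fin d)) x).source := by
  intro y hy
  set t := trivializationAt (EuclideanSpace ℝ (Fin d)) (fun x : N => TangentSpace (𝓡 d) x) x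
  have hb : t.baseSet = (chartAt (EuclideanSpace ℝ (Fin d)) x).source :=
    TangentBundle.trivializationAt_baseSet x
  rw [t.contMDiffWithinAt_section _ (by rwa [hb])]
  have h : ContMDiffOn (𝓡 d) 𝓘(ℝ, EuclideanSpace ℝ (Fin d)) ∞
      (fun _ : N => (t ⟨x, v⟩).2) (chartAt (EuclideanSpace ℝ (Fin d)) x).source :=
    contMDiffOn_const
  refine h.congr (fun z hz => ?_) y hy
  have hz' : z ∈ t.baseSet := by rwa [hb]
  change (t ⟨z, t.symm z (t ⟨x, v⟩).2⟩).2 = _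
  rw [t.apply_mk_symm hz']

/-- Each tangent vector `v` at `x` extends to a smooth vector field which near `x` is constant in
the coordinates of the chart at `x`. -/
theorem exists_smooth_extension [T2Space N] {x : N} (v : TangentSpace (𝓡 d) x) :
    ∃ X : ∀ x : N, TangentSpace (𝓡 d) x, IsSmoothVectorField X ∧
      ∀ᶠ y in 𝓝 x, X y = FiberBundle.extend (E := fun x : N => TangentSpace (𝓡 d) x)
        (EuclideanSpace ℝ (Fin d)) v y := by
  let f : SmoothBumpFunction (𝓡 d) x := Classical.choice inferInstance
  refine ⟨fun y => f y • FiberBundle.extend (E := fun x : N => TangentSpace (𝓡 d) x)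
    (EuclideanSpace ℝ (Fin d)) v y, ?_, ?_⟩
  · exact ContMDiffOn.smul_section_of_tsupport (f.contMDiff.contMDiffOn)
      (chartAt (EuclideanSpace ℝ (Fin d)) x).open_source f.tsupport_subset_chartAt_source
      (contMDiffOn_extend v)
  · filter_upwards [f.eventuallyEq_one] with y hy
    rw [hy]; simp

theorem exists_smooth_field_eq [T2Space N] {x : N} (v : TangentSpace (𝓡 d) x) :
    ∃ X : ∀ x : N, TangentSpace (𝓡 d) x, IsSmoothVectorField X ∧ X x = v := by
  obtain ⟨X, hX, h⟩ := exists_smooth_extension v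
  exact ⟨X, hX, by rw [h.self_of_nhds]; exact FiberBundle.extend_apply_self _ v⟩

/-- The Lie bracket acts on functions as the commutator of derivations. -/
theorem mvfderiv_mlieBracket [T2Space N] (hX : IsSmoothVectorField X) (hY : IsSmoothVectorField Y)
    {f : N → ℝ} (hf : ContMDiff (𝓡 d) 𝓘(ℝ, ℝ) ∞ f) (x : N) :
    mvfderiv (𝓡 d) f x (VectorField.mlieBracket (𝓡 d) X Y x) =
      mvfderiv (𝓡 d) (fun y => mvfderiv (𝓡 d) f y (Y y)) x (X x)
        - mvfderiv (𝓡 d) (fun y => mvfderiv (𝓡 d) f y (X y)) x (Y x) := by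
  by_cases hx : ∃ v : TangentSpace (𝓡 d) x, v ≠ 0
  swap
  · push Not at hx
    rw [hx (VectorField.mlieBracket (𝓡 d) X Y x), hx (X x), hx (Y x)]
    simp
  obtain ⟨v, hv⟩ := hx
  obtain ⟨Z, hZ, rfl⟩ := exists_smooth_field_eq v
  have : IsManifold (𝓡 d) (minSmoothness ℝ 2) N := isManifold_minSmoothness 2
  have : IsManifold (𝓡 d) (minSmoothness ℝ 3) N := isManifold_minSmoothness 3
  have hle : minSmoothness ℝ 2 ≤ (∞ : WithTop ℕ∞) := by
    rw [minSmoothness_of_isRCLikeNormedField]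
    exact ENat.LEInfty.out
  have hfd : ∀ y, MDifferentiableAt (𝓡 d) 𝓘(ℝ, ℝ) f y := fun y =>
    (hf y).mdifferentiableAt (by simp)
  have hYf := hY.mvfderiv hf
  have hXf := hX.mvfderiv hf
  have hYfd : ∀ y, MDifferentiableAt (𝓡 d) 𝓘(ℝ, ℝ) (fun y => mvfderiv (𝓡 d) f y (Y y)) y :=
    fun y => (hYf y).mdifferentiableAt (by simp)
  have hXfd : ∀ y, MDifferentiableAt (𝓡 d) 𝓘(ℝ, ℝ) (fun y => mvfderiv (𝓡 d) f y (X y)) y :=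
    fun y => (hXf y).mdifferentiableAt (by simp)
  -- Jacobi for `X`, `Y`, `f • Z` minus `f` times Jacobi for `X`, `Y`, `Z` leaves the claimed
  -- identity times `Z x`, which is nonzero.
  have hJf := congrFun (VectorField.leibniz_identity_mlieBracket (hX.of_le hle) (hY.of_le hle)
    ((hZ.smul hf).of_le hle)) x
  have hJ := congrFun (VectorField.leibniz_identity_mlieBracket (hX.of_le hle) (hY.of_le hle)
    (hZ.of_le hle)) x
  have e1 : VectorField.mlieBracket (𝓡 d) Y (f • Z) =
      (fun y => mvfderiv (𝓡 d) f y (Y y)) • Z + f • VectorField.mlieBracket (𝓡 d) Y Z := by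
    ext1 y
    rw [VectorField.mlieBracket_smul_right (hfd y) (hZ.mdifferentiableAt y)]
    rfl
  have e2 : VectorField.mlieBracket (𝓡 d) X (f • Z) =
      (fun y => mvfderiv (𝓡 d) f y (X y)) • Z + f • VectorField.mlieBracket (𝓡 d) X Z := by
    ext1 y
    rw [VectorField.mlieBracket_smul_right (hfd y) (hZ.mdifferentiableAt y)]
    rfl
  rw [e1, e2, Pi.add_apply,
    VectorField.mlieBracket_add_right ((hZ.smul hYf).mdifferentiableAt x)
      (((hY.mlieBracket hZ).smul hf).mdifferentiableAt x),
    VectorField.mlieBracket_add_right ((hZ.smul hXf).mdifferentiableAt x)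
      (((hX.mlieBracket hZ).smul hf).mdifferentiableAt x),
    VectorField.mlieBracket_smul_right (hfd x) (hZ.mdifferentiableAt x),
    VectorField.mlieBracket_smul_right (hYfd x) (hZ.mdifferentiableAt x),
    VectorField.mlieBracket_smul_right (hXfd x) (hZ.mdifferentiableAt x),
    VectorField.mlieBracket_smul_right (hfd x) ((hX.mlieBracket hZ).mdifferentiableAt x),
    VectorField.mlieBracket_smul_right (hfd x) ((hY.mlieBracket hZ).mdifferentiableAt x), hJ] at hJf
  have hJf' : (mvfderiv (𝓡 d) f x (VectorField.mlieBracket (𝓡 d) X Y x) -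
      (mvfderiv (𝓡 d) (fun y => mvfderiv (𝓡 d) f y (Y y)) x (X x)
        - mvfderiv (𝓡 d) (fun y => mvfderiv (𝓡 d) f y (X y)) x (Y x))) • Z x = 0 := by
    simp only [Pi.add_apply] at hJf
    rw [← sub_eq_zero] at hJf
    rw [← neg_eq_zero, ← hJf]
    module
  exact sub_eq_zero.mp ((smul_eq_zero.mp hJf').resolve_right hv)

end Fields

/-! ### Symmetries and tensoriality of the Levi-Civita curvature. -/

section LeviCivita
variable {d : ℕ} {N : Type*} [TopologicalSpace N] [ChartedSpace (EuclideanSpace ℝ (Fin d)) N]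
  [IsManifold (𝓡 d) ∞ N] {X Y Z W X' Y' Z' : ∀ x : N, TangentSpace (𝓡 d) x}
  {nabla : CovariantDerivative (𝓡 d) (EuclideanSpace ℝ (Fin d))
      (fun x : N => TangentSpace (𝓡 d) x)}

theorem covDeriv_sub_left : covDeriv nabla (X - Y) Z = covDeriv nabla X Z - covDeriv nabla Y Z := by
  ext1 x
  exact map_sub (nabla Z x) (X x) (Y x)

theorem covDeriv_add (hY : IsSmoothVectorField Y) (hZ : IsSmoothVectorField Z) :
    covDeriv nabla X (Y + Z) = covDeriv nabla X Y + covDeriv nabla X Z := by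
  ext1 x
  simp [covDeriv, nabla.isCovariantDerivativeOn.add (hY.mdifferentiableAt x)
    (hZ.mdifferentiableAt x)]

theorem covDeriv_smul_apply (hY : IsSmoothVectorField Y) {f : N → ℝ}
    (hf : ContMDiff (𝓡 d) 𝓘(ℝ, ℝ) ∞ f) (x : N) :
    covDeriv nabla X (f • Y) x = f x • covDeriv nabla X Y x + mvfderiv (𝓡 d) f x (X x) • Y x := by
  simp [covDeriv, nabla.isCovariantDerivativeOn.leibniz (hY.mdifferentiableAt x)
    ((hf x).mdifferentiableAt (by simp))]

theorem covDeriv_neg (hY : IsSmoothVectorField Y) :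
    covDeriv nabla X (-Y) = -covDeriv nabla X Y := by
  ext1 x
  have := nabla.isCovariantDerivativeOn.smul_const (s := Set.univ) (-1) (hY.mdifferentiableAt x)
  rw [neg_one_smul, neg_one_smul] at this
  simp [covDeriv, this]

theorem covDeriv_sub (hY : IsSmoothVectorField Y) (hZ : IsSmoothVectorField Z) :
    covDeriv nabla X (Y - Z) = covDeriv nabla X Y - covDeriv nabla X Z := by
  rw [sub_eq_add_neg, covDeriv_add hY hZ.neg, covDeriv_neg hZ, sub_eq_add_neg]

theorem covDeriv_congr_of_eventuallyEq {x : N} (hX : X x = X' x)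
    (hY : MDifferentiableAt (𝓡 d) (𝓡 d).tangent
      (fun x : N => (⟨x, Y x⟩ : TangentBundle (𝓡 d) N)) x)
    (hY' : MDifferentiableAt (𝓡 d) (𝓡 d).tangent
      (fun x : N => (⟨x, Y' x⟩ : TangentBundle (𝓡 d) N)) x)
    (h : ∀ᶠ y in 𝓝 x, Y y = Y' y) : covDeriv nabla X Y x = covDeriv nabla X' Y' x := by
  simp only [covDeriv]
  rw [nabla.isCovariantDerivativeOnUniv.congr_of_eventuallyEq hY hY' Filter.univ_mem h, hX]

theorem curvatureField_antisymm (x : N) :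
    curvatureField nabla X Y Z x = -curvatureField nabla Y X Z x := by
  simp only [curvatureField, covDeriv, VectorField.mlieBracket_swap_apply (V := X), map_neg]
  abel

variable [RiemannianBundle (fun x : N => TangentSpace (𝓡 d) x)]

theorem eq_zero_of_inner_field [T2Space N] {x : N} {u : TangentSpace (𝓡 d) x}
    (h : ∀ W : (∀ x : N, TangentSpace (𝓡 d) x), IsSmoothVectorField W → inner ℝ u (W x) = (0 : ℝ)) :
    u = 0 := by
  obtain ⟨W, hW, hWx⟩ := exists_smooth_field_eq u
  have := h W hW
  rw [hWx] at this
  exact inner_self_eq_zero.mp this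

variable [IsContMDiffRiemannianBundle (𝓡 d) ∞ (EuclideanSpace ℝ (Fin d))
      (fun x : N => TangentSpace (𝓡 d) x)]

theorem IsSmoothVectorField.inner (hX : IsSmoothVectorField X) (hY : IsSmoothVectorField Y) :
    ContMDiff (𝓡 d) 𝓘(ℝ, ℝ) ∞ (fun x => (inner ℝ (X x) (Y x) : ℝ)) :=
  ContMDiff.inner_bundle hX hY

namespace IsLeviCivita

variable (hn : IsLeviCivita nabla)
include hn

theorem isSmooth_covDeriv (hX : IsSmoothVectorField X) (hY : IsSmoothVectorField Y) :
    IsSmoothVectorField (covDeriv nabla X Y) := by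
  have h1 := contMDiffOn_univ.mp (hn.smooth.contMDiff.contMDiff
    (σ := Y) (contMDiffOn_univ.mpr hY))
  exact ContMDiff.clm_bundle_apply h1 hX

theorem covDeriv_sub_covDeriv (hX : IsSmoothVectorField X) (hY : IsSmoothVectorField Y) :
    covDeriv nabla X Y - covDeriv nabla Y X = VectorField.mlieBracket (𝓡 d) X Y := by
  ext1 x
  exact nabla.torsion_eq_zero_iff.mp hn.torsion_free (hX.mdifferentiableAt x)
    (hY.mdifferentiableAt x)

set_option synthInstance.maxHeartbeats 200000 in
theorem mvfderiv_inner (hY : IsSmoothVectorField Y) (hZ : IsSmoothVectorField Z) (x : N) :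
    mvfderiv (𝓡 d) (fun y => (inner ℝ (Y y) (Z y) : ℝ)) x (X x) =
      inner ℝ (covDeriv nabla X Y x) (Z x) + inner ℝ (Y x) (covDeriv nabla X Z x) :=
  hn.metric.mvfderiv_inner_eq X (hY.mdifferentiableAt x) (hZ.mdifferentiableAt x)

/-- Vanishing torsion turns the cyclic sum of second covariant derivatives into iterated brackets,
and the Jacobi identity finishes. -/
theorem curvatureField_bianchi (hX : IsSmoothVectorField X) (hY : IsSmoothVectorField Y)
    (hZ : IsSmoothVectorField Z) (x : N) :
    curvatureField nabla X Y Z x + curvatureField nabla Y Z X x + curvatureField nabla Z X Y x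
      = 0 := by
  have : IsManifold (𝓡 d) (minSmoothness ℝ 2) N := isManifold_minSmoothness 2
  have : IsManifold (𝓡 d) (minSmoothness ℝ 3) N := isManifold_minSmoothness 3
  have hle : minSmoothness ℝ 2 ≤ (∞ : WithTop ℕ∞) := by
    rw [minSmoothness_of_isRCLikeNormedField]
    exact ENat.LEInfty.out
  have hJ := congrFun (VectorField.leibniz_identity_mlieBracket (hX.of_le hle) (hY.of_le hle)
    (hZ.of_le hle)) x
  have key : ∀ {X Y Z : ∀ x : N, TangentSpace (𝓡 d) x}, IsSmoothVectorField X →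
      IsSmoothVectorField Y → IsSmoothVectorField Z →
      covDeriv nabla X (covDeriv nabla Y Z) x - covDeriv nabla X (covDeriv nabla Z Y) x
        - covDeriv nabla (VectorField.mlieBracket (𝓡 d) Y Z) X x
      = VectorField.mlieBracket (𝓡 d) X (VectorField.mlieBracket (𝓡 d) Y Z) x := by
    intro X Y Z hX hY hZ
    rw [← hn.covDeriv_sub_covDeriv hX (hY.mlieBracket hZ), Pi.sub_apply,
      ← hn.covDeriv_sub_covDeriv hY hZ, covDeriv_sub (hn.isSmooth_covDeriv hY hZ)
        (hn.isSmooth_covDeriv hZ hY), Pi.sub_apply]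
  have k1 := key hX hY hZ
  have k2 := key hY hZ hX
  have k3 := key hZ hX hY
  have s1 : VectorField.mlieBracket (𝓡 d) (VectorField.mlieBracket (𝓡 d) X Y) Z x
      = -VectorField.mlieBracket (𝓡 d) Z (VectorField.mlieBracket (𝓡 d) X Y) x :=
    VectorField.mlieBracket_swap_apply
  have s2 : VectorField.mlieBracket (𝓡 d) Y (VectorField.mlieBracket (𝓡 d) X Z) x
      = -VectorField.mlieBracket (𝓡 d) Y (VectorField.mlieBracket (𝓡 d) Z X) x := by
    rw [← hn.covDeriv_sub_covDeriv hX hZ, ← hn.covDeriv_sub_covDeriv hZ hX]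
    rw [← neg_sub (covDeriv nabla Z X), ← neg_one_smul ℝ (covDeriv nabla Z X - covDeriv nabla X Z),
      VectorField.mlieBracket_const_smul_right
        (((hn.isSmooth_covDeriv hZ hX).sub (hn.isSmooth_covDeriv hX hZ)).mdifferentiableAt x),
      neg_one_smul]
  rw [Pi.add_apply, s1, s2, ← k1, ← k2, ← k3] at hJ
  simp only [curvatureField]
  rw [← sub_eq_zero] at hJ
  rw [← hJ]
  abel

/-- Metric compatibility applied twice to $g(Z,Z)$: the commutator of the derivations $X$ and $Y$ on
this function equals its derivative along $[X,Y]$, and the first-order products cancel. -/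
theorem inner_curvatureField_self [T2Space N] (hX : IsSmoothVectorField X)
    (hY : IsSmoothVectorField Y) (hZ : IsSmoothVectorField Z) (x : N) :
    (inner ℝ (curvatureField nabla X Y Z x) (Z x) : ℝ) = 0 := by
  have h := mvfderiv_mlieBracket hX hY (hZ.inner hZ) x
  have hXY : IsSmoothVectorField (VectorField.mlieBracket (𝓡 d) X Y) := hX.mlieBracket hY
  have e : ∀ {X : ∀ x : N, TangentSpace (𝓡 d) x},
      (fun y => mvfderiv (𝓡 d) (fun y => (inner ℝ (Z y) (Z y) : ℝ)) y (X y)) =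
        (fun y => (inner ℝ (Z y) (covDeriv nabla X Z y) : ℝ)
          + inner ℝ (Z y) (covDeriv nabla X Z y)) := by
    intro X
    ext y
    rw [hn.mvfderiv_inner hZ hZ, real_inner_comm]
  have d1 : ∀ {X Y : ∀ x : N, TangentSpace (𝓡 d) x}, IsSmoothVectorField X →
      IsSmoothVectorField Y → mvfderiv (𝓡 d) (fun y => (inner ℝ (Z y) (covDeriv nabla X Z y) : ℝ)
          + inner ℝ (Z y) (covDeriv nabla X Z y)) x (Y x) =
        2 * (inner ℝ (covDeriv nabla Y Z x) (covDeriv nabla X Z x)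
          + inner ℝ (Z x) (covDeriv nabla Y (covDeriv nabla X Z) x)) := by
    intro X Y hX hY
    have hs := ((hZ.inner (hn.isSmooth_covDeriv hX hZ)) x).mdifferentiableAt
      (n := ∞) (by simp)
    rw [mvfderiv_fun_add hs hs, add_apply,
      hn.mvfderiv_inner hZ (hn.isSmooth_covDeriv hX hZ)]
    ring
  rw [e, e, hn.mvfderiv_inner hZ hZ, d1 hX hY, d1 hY hX,
    real_inner_comm (Z x) (covDeriv nabla _ Z x),
    real_inner_comm (covDeriv nabla Y Z x) (covDeriv nabla X Z x)] at h
  rw [real_inner_comm]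
  simp only [curvatureField, inner_sub_right]
  linarith

theorem curvatureField_add (hX : IsSmoothVectorField X) (hY : IsSmoothVectorField Y)
    (hZ : IsSmoothVectorField Z) (hW : IsSmoothVectorField W) (x : N) :
    curvatureField nabla X Y (Z + W) x = curvatureField nabla X Y Z x
      + curvatureField nabla X Y W x := by
  simp only [curvatureField, covDeriv_add hZ hW, covDeriv_add (hn.isSmooth_covDeriv hX hZ)
    (hn.isSmooth_covDeriv hX hW), covDeriv_add (hn.isSmooth_covDeriv hY hZ)
    (hn.isSmooth_covDeriv hY hW), Pi.add_apply]
  abel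

theorem inner_curvatureField_antisymm [T2Space N] (hX : IsSmoothVectorField X)
    (hY : IsSmoothVectorField Y) (hZ : IsSmoothVectorField Z) (hW : IsSmoothVectorField W) (x : N) :
    (inner ℝ (curvatureField nabla X Y Z x) (W x) : ℝ)
      = -inner ℝ (curvatureField nabla X Y W x) (Z x) := by
  have h := hn.inner_curvatureField_self hX hY (hZ.add hW) x
  rw [hn.curvatureField_add hX hY hZ hW, Pi.add_apply, inner_add_left, inner_add_right,
    inner_add_right, hn.inner_curvatureField_self hX hY hZ,
    hn.inner_curvatureField_self hX hY hW] at h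
  linarith

/-- The classical octahedron argument: four Bianchi identities combined with the two
skew-symmetries. -/
theorem inner_curvatureField_pair [T2Space N] (hX : IsSmoothVectorField X)
    (hY : IsSmoothVectorField Y) (hZ : IsSmoothVectorField Z) (hW : IsSmoothVectorField W) (x : N) :
    (inner ℝ (curvatureField nabla X Y Z x) (W x) : ℝ)
      = inner ℝ (curvatureField nabla Z W X x) (Y x) := by
  have b : ∀ {X Y Z W : ∀ x : N, TangentSpace (𝓡 d) x}, IsSmoothVectorField X →
      IsSmoothVectorField Y → IsSmoothVectorField Z → IsSmoothVectorField W →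
      (inner ℝ (curvatureField nabla X Y Z x) (W x) : ℝ)
        + inner ℝ (curvatureField nabla Y Z X x) (W x)
        + inner ℝ (curvatureField nabla Z X Y x) (W x) = 0 := by
    intro X Y Z W hX hY hZ hW
    rw [← inner_add_left, ← inner_add_left, hn.curvatureField_bianchi hX hY hZ, inner_zero_left]
  have a : ∀ (X Y Z W : ∀ x : N, TangentSpace (𝓡 d) x),
      (inner ℝ (curvatureField nabla X Y Z x) (W x) : ℝ)
        = -inner ℝ (curvatureField nabla Y X Z x) (W x) := by
    intro X Y Z W
    rw [curvatureField_antisymm, inner_neg_left]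
  have b1 := b hX hY hZ hW
  have b2 := b hY hZ hW hX
  have b3 := b hZ hW hX hY
  have b4 := b hW hX hY hZ
  have a1 := hn.inner_curvatureField_antisymm hX hY hZ hW x
  have a2 := hn.inner_curvatureField_antisymm hY hZ hX hW x
  have a3 := hn.inner_curvatureField_antisymm hZ hX hY hW x
  have a4 := hn.inner_curvatureField_antisymm hZ hW hX hY x
  have a5 := hn.inner_curvatureField_antisymm hW hY hZ hX x
  have a6 := hn.inner_curvatureField_antisymm hW hX hZ hY x
  have c1 := a Z X Y W
  have c2 := a W Y X Z
  have c3 := a W Y Z X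
  have c4 := a X Z W Y
  have c5 := a X Z Y W
  linarith

/-- The curvature `g(R(X, Y)Z, W)` at a point depends only on the values of the fields there. -/
theorem curvatureField_congr [T2Space N] (hX : IsSmoothVectorField X)
    (hY : IsSmoothVectorField Y) (hZ : IsSmoothVectorField Z) (hX' : IsSmoothVectorField X')
    (hY' : IsSmoothVectorField Y') (hZ' : IsSmoothVectorField Z') {x : N}
    (eX : X x = X' x) (eY : Y x = Y' x) (eZ : Z x = Z' x) :
    curvatureField nabla X Y Z x = curvatureField nabla X' Y' Z' x := by
  rw [← sub_eq_zero]
  refine eq_zero_of_inner_field fun W hW => ?_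
  rw [inner_sub_left, sub_eq_zero]
  -- The inner product sees only the value at `x` of its second argument. The symmetries bring `Z`,
  -- `Y` and `X` into that position in turn, so no separate linearity over functions is needed.
  have e3 : (inner ℝ (curvatureField nabla X Y Z x) (W x) : ℝ)
      = inner ℝ (curvatureField nabla X Y Z' x) (W x) := by
    rw [hn.inner_curvatureField_antisymm hX hY hZ hW, eZ,
      ← hn.inner_curvatureField_antisymm hX hY hZ' hW]
  have e2 : (inner ℝ (curvatureField nabla X Y Z' x) (W x) : ℝ)
      = inner ℝ (curvatureField nabla X Y' Z' x) (W x) := by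
    rw [hn.inner_curvatureField_pair hX hY hZ' hW, eY,
      ← hn.inner_curvatureField_pair hX hY' hZ' hW]
  have e1 : (inner ℝ (curvatureField nabla X Y' Z' x) (W x) : ℝ)
      = inner ℝ (curvatureField nabla X' Y' Z' x) (W x) := by
    rw [hn.inner_curvatureField_pair hX hY' hZ' hW, hn.inner_curvatureField_antisymm hZ' hW hX hY',
      eX, ← hn.inner_curvatureField_antisymm hZ' hW hX' hY',
      ← hn.inner_curvatureField_pair hX' hY' hZ' hW]
  rw [e3, e2, e1]

omit hn in
omit [RiemannianBundle (fun x : N => TangentSpace (𝓡 d) x)] [IsContMDiffRiemannianBundle (𝓡 d) ∞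
  (EuclideanSpace ℝ (Fin d)) (fun x : N => TangentSpace (𝓡 d) x)] in
theorem covDeriv_eventuallyEq {x : N} (hZ : IsSmoothVectorField Z)
    (eX : ∀ᶠ y in 𝓝 x, X y = X' y) (eZ : ∀ᶠ y in 𝓝 x, Z y = Z' y) :
    ∀ᶠ y in 𝓝 x, covDeriv nabla X Z y = covDeriv nabla X' Z' y := by
  filter_upwards [eX, eZ.eventually_nhds] with y hy hy'
  refine covDeriv_congr_of_eventuallyEq hy (hZ.mdifferentiableAt y) ?_ hy'
  refine (hZ.mdifferentiableAt y).congr_of_eventuallyEq ?_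
  filter_upwards [hy'] with z hz
  rw [hz]

theorem curvatureField_congr_of_eventuallyEq {x : N} (hX : IsSmoothVectorField X)
    (hY : IsSmoothVectorField Y) (hZ : IsSmoothVectorField Z)
    (eX : ∀ᶠ y in 𝓝 x, X y = X' y) (eY : ∀ᶠ y in 𝓝 x, Y y = Y' y)
    (eZ : ∀ᶠ y in 𝓝 x, Z y = Z' y) :
    curvatureField nabla X Y Z x = curvatureField nabla X' Y' Z' x := by
  have h1 := (covDeriv_eventuallyEq (nabla := nabla) (hn.isSmooth_covDeriv hY hZ) eX
    (covDeriv_eventuallyEq hZ eY eZ)).self_of_nhds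
  have h2 := (covDeriv_eventuallyEq (nabla := nabla) (hn.isSmooth_covDeriv hX hZ) eY
    (covDeriv_eventuallyEq hZ eX eZ)).self_of_nhds
  have h3 : ∀ᶠ y in 𝓝 x, VectorField.mlieBracket (𝓡 d) X Y y
      = VectorField.mlieBracket (𝓡 d) X' Y' y :=
    Filter.EventuallyEq.mlieBracket_vectorField eX eY
  have h4 := (covDeriv_eventuallyEq (nabla := nabla) hZ h3 eZ).self_of_nhds
  simp only [curvatureField, h1, h2, h4]

/-- The fields in the definition of `curvature` are smooth only near `x`. Global smooth fields with
the same germs bridge to `curvatureField_congr`. -/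
theorem curvature_eq_curvatureField [T2Space N] (hX : IsSmoothVectorField X)
    (hY : IsSmoothVectorField Y) (hZ : IsSmoothVectorField Z) (x : N) :
    curvature nabla x (X x) (Y x) (Z x) = curvatureField nabla X Y Z x := by
  obtain ⟨X', hX', eX⟩ := exists_smooth_extension (X x)
  obtain ⟨Y', hY', eY⟩ := exists_smooth_extension (Y x)
  obtain ⟨Z', hZ', eZ⟩ := exists_smooth_extension (Z x)
  rw [hn.curvatureField_congr hX hY hZ hX' hY' hZ']
  · exact (hn.curvatureField_congr_of_eventuallyEq hX' hY' hZ' eX eY eZ).symm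
  · rw [eX.self_of_nhds]; exact (FiberBundle.extend_apply_self _ _).symm
  · rw [eY.self_of_nhds]; exact (FiberBundle.extend_apply_self _ _).symm
  · rw [eZ.self_of_nhds]; exact (FiberBundle.extend_apply_self _ _).symm

end IsLeviCivita
end LeviCivita

/-! ### Contact metric structures and the tensor $\nabla\varphi$. -/

section Contact
variable {n : ℕ} {N : Type*} [TopologicalSpace N]
  [ChartedSpace (EuclideanSpace ℝ (Fin (2 * n + 1))) N] [IsManifold (𝓡 (2 * n + 1)) ∞ N]
  [RiemannianBundle (fun x : N => TangentSpace (𝓡 (2 * n + 1)) x)]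
  {X Y Z W : ∀ x : N, TangentSpace (𝓡 (2 * n + 1)) x}
  {nabla : CovariantDerivative (𝓡 (2 * n + 1)) (EuclideanSpace ℝ (Fin (2 * n + 1)))
      (fun x : N => TangentSpace (𝓡 (2 * n + 1)) x)}

namespace ContactMetricStructure

variable (S : ContactMetricStructure n N)

/-- $\varphi^2\xi=0$, so evaluating $\varphi^2$ at $\varphi\xi$ shows $\varphi\xi=k\xi$; one more
$\varphi$ gives $k^2\xi=0$. -/
theorem φ_ξ (x : N) : S.φ x (S.ξ x) = 0 := by
  have h1 : S.φ x (S.φ x (S.ξ x)) = 0 := by rw [S.φ_sq, S.η_ξ]; simp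
  have h2 := S.φ_sq x (S.φ x (S.ξ x))
  rw [h1, map_zero] at h2
  have h3 : S.φ x (S.ξ x) = S.η x (S.φ x (S.ξ x)) • S.ξ x := neg_add_eq_zero.mp h2.symm
  obtain ⟨k, hk⟩ : ∃ k : ℝ, k = S.η x (S.φ x (S.ξ x)) := ⟨_, rfl⟩
  rw [← hk] at h3
  rw [h3, map_smul, h3, smul_smul] at h1
  have h4 := congrArg (S.η x) h1
  rw [map_smul, S.η_ξ, (S.η x).map_zero, smul_eq_mul, mul_one] at h4
  rw [h3, mul_self_eq_zero.mp h4, zero_smul]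

theorem η_eq_inner (x : N) (u : TangentSpace (𝓡 (2 * n + 1)) x) :
    S.η x u = inner ℝ u (S.ξ x) := by
  have h := S.inner_φ_φ x u (S.ξ x)
  rw [S.φ_ξ, inner_zero_right, S.η_ξ] at h
  linarith

theorem inner_ξ_ξ (x : N) : (inner ℝ (S.ξ x) (S.ξ x) : ℝ) = 1 := by
  rw [← S.η_eq_inner, S.η_ξ]

theorem φ_sq' (x : N) (u : TangentSpace (𝓡 (2 * n + 1)) x) :
    S.φ x (S.φ x u) = -u + (inner ℝ u (S.ξ x) : ℝ) • S.ξ x := by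
  rw [S.φ_sq, S.η_eq_inner]

omit [IsManifold (𝓡 (2 * n + 1)) ∞ N]
  [RiemannianBundle (fun x : N => TangentSpace (𝓡 (2 * n + 1)) x)] in
theorem extDerivOneForm_swap (η : ∀ x : N, TangentSpace (𝓡 (2 * n + 1)) x →L[ℝ] ℝ) (x : N) :
    extDerivOneForm η X Y x = -extDerivOneForm η Y X x := by
  simp only [extDerivOneForm]
  rw [VectorField.mlieBracket_swap_apply, map_neg]
  ring

theorem inner_φ_left [T2Space N] (x : N) (u v : TangentSpace (𝓡 (2 * n + 1)) x) :
    (inner ℝ (S.φ x u) v : ℝ) = -inner ℝ u (S.φ x v) := by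
  obtain ⟨X, hX, rfl⟩ := exists_smooth_field_eq u
  obtain ⟨Y, hY, rfl⟩ := exists_smooth_field_eq v
  rw [S.inner_φ X Y hX hY, real_inner_comm, S.inner_φ Y X hY hX, extDerivOneForm_swap]

theorem isSmooth_φField (hX : IsSmoothVectorField X) : IsSmoothVectorField (S.φField X) :=
  ContMDiff.clm_bundle_apply S.smooth_φ hX

/-- The vector field `(∇_X φ) Y`. -/
def covDerivφ (nabla : CovariantDerivative (𝓡 (2 * n + 1)) (EuclideanSpace ℝ (Fin (2 * n + 1)))
      (fun x : N => TangentSpace (𝓡 (2 * n + 1)) x))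
    (X Y : ∀ x : N, TangentSpace (𝓡 (2 * n + 1)) x) (x : N) : TangentSpace (𝓡 (2 * n + 1)) x :=
  covDeriv nabla X (S.φField Y) x - S.φ x (covDeriv nabla X Y x)

theorem covDerivφ_ξ (x : N) : S.covDerivφ nabla X S.ξ x = -S.φ x (covDeriv nabla X S.ξ x) := by
  have e : S.φField S.ξ = 0 := by
    ext1 y
    exact S.φ_ξ y
  simp [covDerivφ, e, covDeriv]

variable [IsContMDiffRiemannianBundle (𝓡 (2 * n + 1)) ∞
  (EuclideanSpace ℝ (Fin (2 * n + 1))) (fun x : N => TangentSpace (𝓡 (2 * n + 1)) x)]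

variable (hn : IsLeviCivita nabla)
include hn

/-- By metric compatibility and vanishing torsion, $2\,d\eta$ is the skew part of $\nabla\xi$. -/
theorem two_mul_inner_φ (hX : IsSmoothVectorField X) (hY : IsSmoothVectorField Y) (x : N) :
    2 * (inner ℝ (X x) (S.φ x (Y x)) : ℝ) =
      inner ℝ (covDeriv nabla X S.ξ x) (Y x) - inner ℝ (covDeriv nabla Y S.ξ x) (X x) := by
  rw [S.inner_φ X Y hX hY, extDerivOneForm]
  simp only [S.η_eq_inner]
  rw [hn.mvfderiv_inner hY S.smooth_ξ, hn.mvfderiv_inner hX S.smooth_ξ,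
    ← hn.covDeriv_sub_covDeriv hX hY, Pi.sub_apply, inner_sub_left,
    real_inner_comm (Y x), real_inner_comm (X x)]
  ring

theorem inner_covDeriv_ξ_ξ (x : N) : (inner ℝ (covDeriv nabla X S.ξ x) (S.ξ x) : ℝ) = 0 := by
  have h := hn.mvfderiv_inner (X := X) S.smooth_ξ S.smooth_ξ x
  simp only [S.inner_ξ_ξ, mvfderiv_const] at h
  rw [real_inner_comm (covDeriv nabla X S.ξ x)] at h
  simp at h
  linarith

theorem covDeriv_ξ_ξ [T2Space N] (x : N) : covDeriv nabla S.ξ S.ξ x = 0 := by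
  refine eq_zero_of_inner_field fun W hW => ?_
  have h := S.two_mul_inner_φ hn hW S.smooth_ξ x
  rw [S.φ_ξ, inner_zero_right, S.inner_covDeriv_ξ_ξ hn] at h
  linarith

theorem covDerivφ_antisymm [T2Space N] (hY : IsSmoothVectorField Y) (hZ : IsSmoothVectorField Z)
    (x : N) :
    (inner ℝ (S.covDerivφ nabla X Y x) (Z x) : ℝ) = -inner ℝ (Y x) (S.covDerivφ nabla X Z x) := by
  have h1 := hn.mvfderiv_inner (X := X) (S.isSmooth_φField hY) hZ x
  have h2 := hn.mvfderiv_inner (X := X) hY (S.isSmooth_φField hZ) x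
  have e : (fun y => (inner ℝ (S.φField Y y) (Z y) : ℝ))
      = fun y => -(inner ℝ (Y y) (S.φField Z y) : ℝ) := by
    ext y
    exact S.inner_φ_left y _ _
  rw [e, mvfderiv_fun_neg, neg_apply, h2] at h1
  have h3 := S.inner_φ_left x (covDeriv nabla X Y x) (Z x)
  have h4 := S.inner_φ_left x (Y x) (covDeriv nabla X Z x)
  simp only [covDerivφ, inner_sub_left, inner_sub_right]
  simp only [φField] at *
  linarith

/-- This is the covariant derivative of $\varphi^2=-I+\eta\otimes\xi$. -/
theorem covDerivφ_φ_add (hY : IsSmoothVectorField Y) (x : N) :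
    S.covDerivφ nabla X (S.φField Y) x + S.φ x (S.covDerivφ nabla X Y x) =
      (inner ℝ (Y x) (covDeriv nabla X S.ξ x) : ℝ) • S.ξ x
        + (inner ℝ (Y x) (S.ξ x) : ℝ) • covDeriv nabla X S.ξ x := by
  have e : S.φField (S.φField Y) = -Y + (fun y => (inner ℝ (Y y) (S.ξ y) : ℝ)) • S.ξ := by
    ext1 y
    exact S.φ_sq' y _
  simp only [covDerivφ, map_sub, S.φ_sq']
  rw [e, covDeriv_add hY.neg (S.smooth_ξ.smul (hY.inner S.smooth_ξ)), covDeriv_neg hY, Pi.add_apply,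
    covDeriv_smul_apply S.smooth_ξ (hY.inner S.smooth_ξ), hn.mvfderiv_inner hY S.smooth_ξ]
  simp only [Pi.neg_apply]
  module

/-- The fundamental two-form of a contact metric structure is closed. -/
theorem covDerivφ_cyclic [T2Space N] (hX : IsSmoothVectorField X) (hY : IsSmoothVectorField Y)
    (hZ : IsSmoothVectorField Z) (x : N) :
    (inner ℝ (X x) (S.covDerivφ nabla Z Y x) : ℝ) + inner ℝ (Y x) (S.covDerivφ nabla X Z x)
      + inner ℝ (Z x) (S.covDerivφ nabla Y X x) = 0 := by
  have key : ∀ {X Y Z : ∀ x : N, TangentSpace (𝓡 (2 * n + 1)) x}, IsSmoothVectorField X →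
      IsSmoothVectorField Y → IsSmoothVectorField Z →
      2 * (inner ℝ (X x) (S.covDerivφ nabla Z Y x) : ℝ) =
        inner ℝ (covDeriv nabla Z (covDeriv nabla X S.ξ) x) (Y x)
        - inner ℝ (covDeriv nabla (covDeriv nabla Z X) S.ξ x) (Y x)
        - inner ℝ (covDeriv nabla Z (covDeriv nabla Y S.ξ) x) (X x)
        + inner ℝ (covDeriv nabla (covDeriv nabla Z Y) S.ξ x) (X x) := by
    intro X Y Z hX hY hZ
    have hAX := hn.isSmooth_covDeriv hX S.smooth_ξ
    have hAY := hn.isSmooth_covDeriv hY S.smooth_ξ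
    have h0 : (fun y => 2 * (inner ℝ (X y) (S.φField Y y) : ℝ)) =
        fun y => (inner ℝ (covDeriv nabla X S.ξ y) (Y y) : ℝ)
          - inner ℝ (covDeriv nabla Y S.ξ y) (X y) := by
      ext y
      exact S.two_mul_inner_φ hn hX hY y
    have h1 := congrArg (fun f => mvfderiv (𝓡 (2 * n + 1)) f x (Z x)) h0
    have hs := ((hX.inner (S.isSmooth_φField hY)) x).mdifferentiableAt (n := ∞) (by simp)
    have hs1 := ((hAX.inner hY) x).mdifferentiableAt (n := ∞) (by simp)
    have hs2 := ((hAY.inner hX) x).mdifferentiableAt (n := ∞) (by simp)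
    have h2 : mvfderiv (𝓡 (2 * n + 1)) (fun y => 2 * (inner ℝ (X y) (S.φField Y y) : ℝ)) x (Z x)
        = 2 * mvfderiv (𝓡 (2 * n + 1)) (fun y => (inner ℝ (X y) (S.φField Y y) : ℝ)) x (Z x) := by
      rw [mvfderiv_fun_mul mdifferentiableAt_const hs]
      simp [mvfderiv_const]
    simp only [h2] at h1
    rw [mvfderiv_fun_sub hs1 hs2, sub_apply, hn.mvfderiv_inner hX (S.isSmooth_φField hY),
      hn.mvfderiv_inner hAX hY, hn.mvfderiv_inner hAY hX] at h1
    have h3 := S.two_mul_inner_φ hn (hn.isSmooth_covDeriv hZ hX) hY x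
    have h4 := S.two_mul_inner_φ hn hX (hn.isSmooth_covDeriv hZ hY) x
    simp only [covDerivφ, inner_sub_right]
    simp only [φField] at *
    linarith
  have k1 := key hX hY hZ
  have k2 := key hY hZ hX
  have k3 := key hZ hX hY
  -- The second derivatives of `ξ` left in the cyclic sum group into curvature terms paired with
  -- `ξ`, which cancel by the Bianchi identity.
  have hR : ∀ {X Y Z : ∀ x : N, TangentSpace (𝓡 (2 * n + 1)) x}, IsSmoothVectorField X →
      IsSmoothVectorField Y → IsSmoothVectorField Z →
      (inner ℝ (covDeriv nabla X (covDeriv nabla Y S.ξ) x) (Z x) : ℝ)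
      - inner ℝ (covDeriv nabla Y (covDeriv nabla X S.ξ) x) (Z x)
      - (inner ℝ (covDeriv nabla (covDeriv nabla X Y) S.ξ x) (Z x)
      - inner ℝ (covDeriv nabla (covDeriv nabla Y X) S.ξ x) (Z x))
      = -inner ℝ (curvatureField nabla X Y Z x) (S.ξ x) := by
    intro X Y Z hX hY hZ
    rw [← hn.inner_curvatureField_antisymm hX hY S.smooth_ξ hZ, curvatureField,
      ← hn.covDeriv_sub_covDeriv hX hY, covDeriv_sub_left, inner_sub_left, inner_sub_left,
      Pi.sub_apply, inner_sub_left]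
  have r1 := hR hX hY hZ
  have r2 := hR hY hZ hX
  have r3 := hR hZ hX hY
  have hb := congrArg (fun u => (inner ℝ u (S.ξ x) : ℝ)) (hn.curvatureField_bianchi hX hY hZ x)
  simp only [inner_add_left, inner_zero_left] at hb
  linarith

end ContactMetricStructure
end Contact

/-! ### Sasakian identities and the curvature of a Sasakian space form. -/

section SasakianIdentities
variable {n : ℕ} {N : Type*} [TopologicalSpace N] [T2Space N]
  [ChartedSpace (EuclideanSpace ℝ (Fin (2 * n + 1))) N] [IsManifold (𝓡 (2 * n + 1)) ∞ N]
  [RiemannianBundle (fun x : N => TangentSpace (𝓡 (2 * n + 1)) x)]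
  [IsContMDiffRiemannianBundle (𝓡 (2 * n + 1)) ∞
  (EuclideanSpace ℝ (Fin (2 * n + 1))) (fun x : N => TangentSpace (𝓡 (2 * n + 1)) x)]
  {X Y Z W : ∀ x : N, TangentSpace (𝓡 (2 * n + 1)) x}
  {nabla : CovariantDerivative (𝓡 (2 * n + 1)) (EuclideanSpace ℝ (Fin (2 * n + 1)))
      (fun x : N => TangentSpace (𝓡 (2 * n + 1)) x)}
  {S : ContactMetricStructure n N}

namespace ContactMetricStructure

omit [IsContMDiffRiemannianBundle (𝓡 (2 * n + 1)) ∞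
  (EuclideanSpace ℝ (Fin (2 * n + 1))) (fun x : N => TangentSpace (𝓡 (2 * n + 1)) x)] in
theorem inner_φ_ξ (S : ContactMetricStructure n N) (x : N)
    (u : TangentSpace (𝓡 (2 * n + 1)) x) : (inner ℝ (S.φ x u) (S.ξ x) : ℝ) = 0 := by
  rw [S.inner_φ_left, S.φ_ξ, inner_zero_right, neg_zero]

omit [IsContMDiffRiemannianBundle (𝓡 (2 * n + 1)) ∞
  (EuclideanSpace ℝ (Fin (2 * n + 1))) (fun x : N => TangentSpace (𝓡 (2 * n + 1)) x)] in
theorem φ_φ_φ (S : ContactMetricStructure n N) (x : N) (u : TangentSpace (𝓡 (2 * n + 1)) x) :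
    S.φ x (S.φ x (S.φ x u)) = -S.φ x u := by
  rw [S.φ_sq', S.inner_φ_ξ, zero_smul, add_zero]

namespace IsSasakian

variable (hS : S.IsSasakian) (hn : IsLeviCivita nabla)
include hS hn

omit [T2Space N] in
-- Writing each bracket as a difference of covariant derivatives makes the derivatives of `X` and
-- `Y` cancel, so only $\nabla\varphi$ survives in the Nijenhuis tensor.
theorem normality_covDerivφ (hX : IsSmoothVectorField X) (hY : IsSmoothVectorField Y) (x : N) :
    S.covDerivφ nabla (S.φField X) Y x - S.covDerivφ nabla (S.φField Y) X x
      + S.φ x (S.covDerivφ nabla Y X x) - S.φ x (S.covDerivφ nabla X Y x)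
      + (2 * (inner ℝ (X x) (S.φ x (Y x)) : ℝ)) • S.ξ x = 0 := by
  have h := hS X Y hX hY x
  rw [← S.inner_φ X Y hX hY, nijenhuis,
    ← hn.covDeriv_sub_covDeriv (S.isSmooth_φField hX) (S.isSmooth_φField hY),
    ← hn.covDeriv_sub_covDeriv (S.isSmooth_φField hX) hY,
    ← hn.covDeriv_sub_covDeriv hX (S.isSmooth_φField hY), ← hn.covDeriv_sub_covDeriv hX hY] at h
  simp only [Pi.sub_apply, map_sub] at h
  rw [← h]
  simp only [covDerivφ, map_sub]
  abel

omit hS in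
-- Closedness of the fundamental form with one argument equal to $\xi$ expresses $\nabla_\xi\varphi$
-- through $\nabla\xi$.
theorem covDerivφ_ξ_left (hX : IsSmoothVectorField X) (x : N) :
    S.covDerivφ nabla S.ξ X x = -(2 : ℝ) • S.φ x (S.φ x (X x))
      - covDeriv nabla (S.φField X) S.ξ x - S.φ x (covDeriv nabla X S.ξ x) := by
  rw [← sub_eq_zero]
  refine eq_zero_of_inner_field fun Y hY => ?_
  have h1 := S.covDerivφ_cyclic hn hY hX S.smooth_ξ x
  have h2 := S.covDerivφ_antisymm hn (X := X) S.smooth_ξ hY x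
  rw [S.covDerivφ_ξ] at h1 h2
  have h3 := S.two_mul_inner_φ hn hY (S.isSmooth_φField hX) x
  have h4 := S.inner_φ_left x (covDeriv nabla X S.ξ x) (Y x)
  have h5 := S.inner_φ_left x (X x) (covDeriv nabla Y S.ξ x)
  rw [inner_neg_left] at h2
  rw [inner_neg_right] at h1
  simp only [inner_sub_left, real_inner_smul_left]
  rw [real_inner_comm (Y x) (S.covDerivφ nabla S.ξ X x),
    real_inner_comm (Y x) (S.φ x (S.φ x (X x)))]
  rw [real_inner_comm (covDeriv nabla Y S.ξ x)] at h5
  simp only [φField] at h3 ⊢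
  linarith

/-- Normality at $(X,\xi)$ yields $\varphi\nabla_{\varphi X}\xi=\varphi X$. Replace $X$ by $\varphi
X$, use $\nabla_\xi\xi=0$, and apply $\varphi$ again; nothing is lost since $\nabla_X\xi\perp\xi$.
-/
theorem covDeriv_ξ (hX : IsSmoothVectorField X) (x : N) :
    covDeriv nabla X S.ξ x = -S.φ x (X x) := by
  have key : ∀ {X : ∀ x : N, TangentSpace (𝓡 (2 * n + 1)) x}, IsSmoothVectorField X →
      S.φ x (covDeriv nabla (S.φField X) S.ξ x) = S.φ x (X x) := by
    intro X hX
    have h1 := hS.normality_covDerivφ hn hX S.smooth_ξ x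
    have h0 : S.covDerivφ nabla (S.φField S.ξ) X x = 0 := by
      simp [covDerivφ, covDeriv, φField, S.φ_ξ]
    rw [h0, S.covDerivφ_ξ, S.covDerivφ_ξ, S.φ_ξ, covDerivφ_ξ_left hn hX, inner_zero_right] at h1
    simp only [map_sub, map_smul, map_neg, S.φ_φ_φ] at h1
    rw [S.φ_sq', S.inner_covDeriv_ξ_ξ hn] at h1
    have h2 : (2 : ℝ) • (S.φ x (X x) - S.φ x (covDeriv nabla (S.φField X) S.ξ x)) = 0 := by
      rw [← h1]
      module
    exact (sub_eq_zero.mp ((smul_eq_zero.mp h2).resolve_left two_ne_zero)).symm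
  have h1 := key (S.isSmooth_φField hX)
  have h2 : covDeriv nabla (S.φField (S.φField X)) S.ξ x = -covDeriv nabla X S.ξ x := by
    have h3 : nabla S.ξ x (S.ξ x) = 0 := S.covDeriv_ξ_ξ hn x
    simp [covDeriv, φField, S.φ_sq', h3]
  rw [h2] at h1
  have h4 := congrArg (S.φ x) h1
  simp only [map_neg, φField, S.φ_φ_φ] at h4
  rw [S.φ_sq', S.inner_covDeriv_ξ_ξ hn, zero_smul, add_zero, neg_neg] at h4
  exact h4

/-- The covariant derivative of `φ` on a Sasakian manifold: `(∇_X φ) Y = g(X, Y) ξ - η(Y) X`. -/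
theorem covDerivφ_eq (hX : IsSmoothVectorField X) (hY : IsSmoothVectorField Y) (x : N) :
    S.covDerivφ nabla X Y x =
      (inner ℝ (X x) (Y x) : ℝ) • S.ξ x - (inner ℝ (Y x) (S.ξ x) : ℝ) • X x := by
  -- `q` is the defect of the claimed formula paired with `Z`. It is skew in the last two arguments,
  -- has zero cyclic sum, and satisfies a homogeneous form of normality.
  set q : (∀ x : N, TangentSpace (𝓡 (2 * n + 1)) x) → (∀ x : N, TangentSpace (𝓡 (2 * n + 1)) x) →
      (∀ x : N, TangentSpace (𝓡 (2 * n + 1)) x) → ℝ := fun X Y Z =>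
    inner ℝ (S.covDerivφ nabla X Y x) (Z x) - inner ℝ (X x) (Y x) * inner ℝ (Z x) (S.ξ x)
      + inner ℝ (Y x) (S.ξ x) * inner ℝ (X x) (Z x) with hq
  have qanti : ∀ {X Y Z : ∀ x : N, TangentSpace (𝓡 (2 * n + 1)) x},
      IsSmoothVectorField Y → IsSmoothVectorField Z → q X Y Z = -q X Z Y := by
    intro X Y Z hY hZ
    simp only [hq]
    rw [S.covDerivφ_antisymm hn hY hZ, real_inner_comm (S.covDerivφ nabla X Z x)]
    ring
  have qφ : ∀ {X Y Z : ∀ x : N, TangentSpace (𝓡 (2 * n + 1)) x},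
      IsSmoothVectorField X → IsSmoothVectorField Y → q X (S.φField Y) Z = q X Y (S.φField Z) := by
    intro X Y Z hX hY
    have h := congrArg (fun u => (inner ℝ u (Z x) : ℝ)) (S.covDerivφ_φ_add hn (X := X) hY x)
    rw [hS.covDeriv_ξ hn hX] at h
    simp only [inner_add_left, real_inner_smul_left, S.inner_φ_left, inner_neg_left,
      inner_neg_right] at h
    simp only [hq, φField, S.inner_φ_ξ] at h ⊢
    have h1 := S.inner_φ_left x (Y x) (X x)
    rw [real_inner_comm] at h1
    rw [real_inner_comm (Z x) (S.ξ x)] at h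
    rw [h1]
    linear_combination h
  have qcyc : ∀ {X Y Z : ∀ x : N, TangentSpace (𝓡 (2 * n + 1)) x},
      IsSmoothVectorField X → IsSmoothVectorField Y → IsSmoothVectorField Z →
      q X Y Z + q Y Z X + q Z X Y = 0 := by
    intro X Y Z hX hY hZ
    have h := S.covDerivφ_cyclic hn hX hZ hY x
    simp only [hq]
    rw [real_inner_comm _ (X x), real_inner_comm _ (Z x), real_inner_comm _ (Y x)] at h
    rw [real_inner_comm (Y x) (X x), real_inner_comm (Z x) (X x), real_inner_comm (Z x) (Y x)]
    linear_combination h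
  have qnorm : ∀ {X Y Z : ∀ x : N, TangentSpace (𝓡 (2 * n + 1)) x},
      IsSmoothVectorField X → IsSmoothVectorField Y →
      q (S.φField X) Y Z - q (S.φField Y) X Z + q X Y (S.φField Z) - q Y X (S.φField Z) = 0 := by
    intro X Y Z hX hY
    have h := congrArg (fun u => (inner ℝ u (Z x) : ℝ)) (hS.normality_covDerivφ hn hX hY x)
    simp only [inner_add_left, inner_sub_left, real_inner_smul_left, S.inner_φ_left,
      inner_zero_left] at h
    simp only [hq, φField, S.inner_φ_ξ, S.inner_φ_left] at h ⊢
    have h1 := S.inner_φ_left x (X x) (Y x)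
    rw [real_inner_comm] at h1
    rw [h1]
    rw [real_inner_comm (Z x) (S.ξ x)] at h
    linear_combination h
  have qzero : ∀ {X Y Z : ∀ x : N, TangentSpace (𝓡 (2 * n + 1)) x},
      IsSmoothVectorField X → IsSmoothVectorField Y → IsSmoothVectorField Z →
      q (S.φField X) Y Z = 0 := by
    -- Normality, the cyclic sum and skewness combine into a three-term relation; adding its cyclic
    -- shift cancels everything except twice `q (φX) Y Z`.
    have h : ∀ {X Y Z : ∀ x : N, TangentSpace (𝓡 (2 * n + 1)) x},
      IsSmoothVectorField X → IsSmoothVectorField Y → IsSmoothVectorField Z →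
      q (S.φField X) Y Z + q (S.φField Y) Z X - q (S.φField Z) X Y = 0 := by
      intro X Y Z hX hY hZ
      have h1 := qnorm (Z := Z) hX hY
      have h2 := qcyc hX hY (S.isSmooth_φField hZ)
      have h3 := qanti (X := S.φField Y) hX hZ
      have h4 := qanti (X := Y) hX (S.isSmooth_φField hZ)
      linarith
    intro X Y Z hX hY hZ
    have h1 := h hX hY hZ
    have h2 := h hZ hX hY
    linarith
  have qξ : ∀ {Y Z : ∀ x : N, TangentSpace (𝓡 (2 * n + 1)) x},
      IsSmoothVectorField Y → IsSmoothVectorField Z → q S.ξ Y Z = 0 := by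
    have h : ∀ {Y Z : ∀ x : N, TangentSpace (𝓡 (2 * n + 1)) x},
      IsSmoothVectorField Y → IsSmoothVectorField Z → q Y S.ξ Z = 0 := by
      intro Y Z hY hZ
      simp only [hq, S.covDerivφ_ξ, hS.covDeriv_ξ hn hY, map_neg, neg_neg, S.φ_sq', inner_add_left,
        inner_neg_left, inner_smul_left, S.inner_ξ_ξ]
      rw [real_inner_comm (Z x) (S.ξ x)]
      simp
    intro Y Z hY hZ
    have h1 := qcyc S.smooth_ξ hY hZ
    have h2 := qanti (X := Y) hZ S.smooth_ξ
    have h3 := h hY hZ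
    have h4 := h hZ hY
    linarith
  rw [← sub_eq_zero]
  refine eq_zero_of_inner_field fun Z hZ => ?_
  have h1 := qzero (S.isSmooth_φField hX) hY hZ
  have h2 := qξ hY hZ
  -- $X=-\varphi^2X+\eta(X)\xi$, so vanishing on the image of `φ` and on `ξ` suffices.
  have h3 : S.covDerivφ nabla (S.φField (S.φField X)) Y x = -S.covDerivφ nabla X Y x
      + (inner ℝ (X x) (S.ξ x) : ℝ) • S.covDerivφ nabla S.ξ Y x := by
    simp only [covDerivφ, covDeriv, φField, S.φ_sq', map_add, map_neg, map_smul]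
    module
  simp only [hq, h3] at h1 h2
  simp only [φField, S.φ_sq', inner_add_left, inner_neg_left, real_inner_smul_left]
    at h1
  simp only [inner_sub_left, real_inner_smul_left]
  rw [real_inner_comm (Z x) (S.ξ x)]
  rw [real_inner_comm (Z x) (S.ξ x)] at h1 h2
  linear_combination (inner ℝ (X x) (S.ξ x)) * h2 - h1

/-- Since $\nabla\xi=-\varphi$, the left side is $(\nabla_Y\varphi)X-(\nabla_X\varphi)Y$. -/
theorem curvatureField_ξ (hX : IsSmoothVectorField X) (hY : IsSmoothVectorField Y) (x : N) :
    curvatureField nabla X Y S.ξ x =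
      (inner ℝ (Y x) (S.ξ x) : ℝ) • X x - (inner ℝ (X x) (S.ξ x) : ℝ) • Y x := by
  have e : ∀ {Y : ∀ x : N, TangentSpace (𝓡 (2 * n + 1)) x}, IsSmoothVectorField Y →
      covDeriv nabla Y S.ξ = -S.φField Y := by
    intro Y hY
    ext1 y
    exact hS.covDeriv_ξ hn hY y
  have h1 := hS.covDerivφ_eq hn hX hY x
  have h2 := hS.covDerivφ_eq hn hY hX x
  rw [curvatureField, e hY, e hX, covDeriv_neg (S.isSmooth_φField hY),
    covDeriv_neg (S.isSmooth_φField hX), e (hX.mlieBracket hY), ← hn.covDeriv_sub_covDeriv hX hY]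
  rw [covDerivφ, sub_eq_iff_eq_add] at h1 h2
  have h3 : S.φField (covDeriv nabla X Y - covDeriv nabla Y X) x
      = S.φ x (covDeriv nabla X Y x) - S.φ x (covDeriv nabla Y X x) := by
    simp [φField]
  simp only [Pi.neg_apply, h3, h1, h2]
  rw [real_inner_comm (X x) (Y x)]
  module

theorem covDeriv_φField (hX : IsSmoothVectorField X) (hY : IsSmoothVectorField Y) :
    covDeriv nabla X (S.φField Y) = S.φField (covDeriv nabla X Y)
      + ((fun y => (inner ℝ (X y) (Y y) : ℝ)) • S.ξ
        - (fun y => (inner ℝ (Y y) (S.ξ y) : ℝ)) • X) := by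
  ext1 x
  have h := hS.covDerivφ_eq hn hX hY x
  rw [covDerivφ, sub_eq_iff_eq_add'] at h
  exact h

/-- The Ricci identity for $\varphi$: the commutator of $R(X,Y)$ with $\varphi$ is the skew part of
$\nabla^2\varphi$, which follows by differentiating the formula for $\nabla\varphi$ and using
$\nabla\xi=-\varphi$. -/
theorem curvatureField_φ (hX : IsSmoothVectorField X) (hY : IsSmoothVectorField Y)
    (hZ : IsSmoothVectorField Z) (x : N) :
    curvatureField nabla X Y (S.φField Z) x = S.φ x (curvatureField nabla X Y Z x)
      - (inner ℝ (Y x) (Z x) : ℝ) • S.φ x (X x) + (inner ℝ (Z x) (S.φ x (X x)) : ℝ) • Y x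
      + (inner ℝ (X x) (Z x) : ℝ) • S.φ x (Y x) - (inner ℝ (Z x) (S.φ x (Y x)) : ℝ) • X x := by
  have e : ∀ {X Y : ∀ x : N, TangentSpace (𝓡 (2 * n + 1)) x}, IsSmoothVectorField X →
      IsSmoothVectorField Y → covDeriv nabla X (covDeriv nabla Y (S.φField Z)) x =
      S.φ x (covDeriv nabla X (covDeriv nabla Y Z) x)
      + ((inner ℝ (X x) (covDeriv nabla Y Z x) : ℝ) • S.ξ x
        - (inner ℝ (covDeriv nabla Y Z x) (S.ξ x) : ℝ) • X x)
      + ((inner ℝ (covDeriv nabla X Y x) (Z x) + inner ℝ (Y x) (covDeriv nabla X Z x) : ℝ) • S.ξ x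
        - (inner ℝ (Y x) (Z x) : ℝ) • S.φ x (X x)
        - ((inner ℝ (covDeriv nabla X Z x) (S.ξ x) - inner ℝ (Z x) (S.φ x (X x)) : ℝ) • Y x
        + (inner ℝ (Z x) (S.ξ x) : ℝ) • covDeriv nabla X Y x)) := by
    intro X Y hX hY
    have hYZ := hn.isSmooth_covDeriv hY hZ
    have s1 := S.smooth_ξ.smul (hY.inner hZ)
    have s2 := hY.smul (hZ.inner S.smooth_ξ)
    rw [hS.covDeriv_φField hn hY hZ, covDeriv_add (S.isSmooth_φField hYZ) (s1.sub s2),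
      covDeriv_sub s1 s2, hS.covDeriv_φField hn hX hYZ]
    simp only [Pi.add_apply, Pi.sub_apply]
    rw [covDeriv_smul_apply S.smooth_ξ (hY.inner hZ), covDeriv_smul_apply hY (hZ.inner S.smooth_ξ),
      hn.mvfderiv_inner hY hZ, hn.mvfderiv_inner hZ S.smooth_ξ, hS.covDeriv_ξ hn hX,
      inner_neg_right]
    simp only [φField, Pi.smul_apply']
    module
  rw [curvatureField, e hX hY, e hY hX, hS.covDeriv_φField hn (hX.mlieBracket hY) hZ,
    ← hn.covDeriv_sub_covDeriv hX hY, curvatureField, ← hn.covDeriv_sub_covDeriv hX hY]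
  simp only [Pi.add_apply, Pi.sub_apply, Pi.smul_apply', map_sub, φField, inner_sub_left]
  module

end IsSasakian

/-- The curvature of a Sasakian space form on horizontal vectors `u`, `v`:
`R(u, v)u = (c + 3) / 4 (g(u, v)u - g(u, u)v) + 3 (c - 1) / 4 g(u, φv) φu`. -/
theorem IsSasakianSpaceForm.curvature_eq {c : ℝ} (hS : S.IsSasakianSpaceForm nabla c)
    (hn : IsLeviCivita nabla) (x : N) (u v : TangentSpace (𝓡 (2 * n + 1)) x)
    (hu : S.η x u = 0) (hv : S.η x v = 0) :
    curvature nabla x u v u =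
      ((c + 3) / 4) • ((inner ℝ u v : ℝ) • u - (inner ℝ u u : ℝ) • v)
        + (3 * (c - 1) / 4 * inner ℝ u (S.φ x v)) • S.φ x u := by
  rw [S.η_eq_inner] at hu hv
  set R : TangentSpace (𝓡 (2 * n + 1)) x → TangentSpace (𝓡 (2 * n + 1)) x →
    TangentSpace (𝓡 (2 * n + 1)) x → TangentSpace (𝓡 (2 * n + 1)) x → ℝ :=
    fun u v w z => inner ℝ (curvature nabla x u v w) z with hR
  have hanti : ∀ x y z w, R x y z w = -R y x z w := by
    intro u v w z
    obtain ⟨X, hX, rfl⟩ := exists_smooth_field_eq u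
    obtain ⟨Y, hY, rfl⟩ := exists_smooth_field_eq v
    obtain ⟨Z, hZ, rfl⟩ := exists_smooth_field_eq w
    simp only [hR]
    rw [hn.curvature_eq_curvatureField hX hY hZ, hn.curvature_eq_curvatureField hY hX hZ,
      curvatureField_antisymm, inner_neg_left]
  have hpair : ∀ x y z w, R x y z w = R z w x y := by
    intro u v w z
    obtain ⟨X, hX, rfl⟩ := exists_smooth_field_eq u
    obtain ⟨Y, hY, rfl⟩ := exists_smooth_field_eq v
    obtain ⟨Z, hZ, rfl⟩ := exists_smooth_field_eq w
    obtain ⟨W, hW, rfl⟩ := exists_smooth_field_eq z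
    simp only [hR]
    rw [hn.curvature_eq_curvatureField hX hY hZ, hn.curvature_eq_curvatureField hZ hW hX,
      hn.inner_curvatureField_pair hX hY hZ hW]
  have hbianchi : ∀ x y z w, R x y z w + R y z x w + R z x y w = 0 := by
    intro u v w z
    obtain ⟨X, hX, rfl⟩ := exists_smooth_field_eq u
    obtain ⟨Y, hY, rfl⟩ := exists_smooth_field_eq v
    obtain ⟨Z, hZ, rfl⟩ := exists_smooth_field_eq w
    simp only [hR]
    rw [hn.curvature_eq_curvatureField hX hY hZ, hn.curvature_eq_curvatureField hY hZ hX,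
      hn.curvature_eq_curvatureField hZ hX hY, ← inner_add_left, ← inner_add_left,
      hn.curvatureField_bianchi hX hY hZ, inner_zero_left]
  -- Linearity is evident only in the fourth slot; skewness and pair symmetry carry it to the first.
  have hadd : ∀ x x' y z w, R (x + x') y z w = R x y z w + R x' y z w := by
    intro u u' v w z
    rw [hanti (u + u'), hpair v (u + u'), hanti u, hpair v u, hanti u', hpair v u']
    simp only [hR, inner_add_right]
    ring
  have hsmul : ∀ (a : ℝ) x y z w, R (a • x) y z w = a * R x y z w := by
    intro a u v w z
    rw [hanti (a • u), hpair v (a • u), hanti u, hpair v u]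
    simp only [hR, real_inner_smul_right]
    ring
  have hRξ : ∀ v w z, R v w (S.ξ x) z = inner ℝ w (S.ξ x) * inner ℝ v z
      - inner ℝ v (S.ξ x) * inner ℝ w z := by
    intro u v z
    obtain ⟨X, hX, rfl⟩ := exists_smooth_field_eq u
    obtain ⟨Y, hY, rfl⟩ := exists_smooth_field_eq v
    simp only [hR]
    rw [hn.curvature_eq_curvatureField hX hY S.smooth_ξ, hS.1.curvatureField_ξ hn hX hY,
      inner_sub_left, real_inner_smul_left, real_inner_smul_left]
  have hRφ : ∀ u v w z, R u v (S.φ x w) z = -R u v w (S.φ x z)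
      - inner ℝ v w * inner ℝ (S.φ x u) z + inner ℝ w (S.φ x u) * inner ℝ v z
      + inner ℝ u w * inner ℝ (S.φ x v) z - inner ℝ w (S.φ x v) * inner ℝ u z := by
    intro u v w z
    obtain ⟨X, hX, rfl⟩ := exists_smooth_field_eq u
    obtain ⟨Y, hY, rfl⟩ := exists_smooth_field_eq v
    obtain ⟨Z, hZ, rfl⟩ := exists_smooth_field_eq w
    simp only [hR]
    have h := hn.curvature_eq_curvatureField hX hY (S.isSmooth_φField hZ) x
    rw [φField] at h
    rw [h, hn.curvature_eq_curvatureField hX hY hZ, hS.1.curvatureField_φ hn hX hY hZ]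
    simp only [inner_sub_left, inner_add_left, real_inner_smul_left]
    rw [S.inner_φ_left x (curvatureField nabla X Y Z x)]
  have hsec : ∀ u, (inner ℝ u u : ℝ) = 1 → (inner ℝ u (S.ξ x) : ℝ) = 0 →
      R u (S.φ x u) (S.φ x u) u = c := by
    intro u h1 h2
    have h := hS.2 x u h1 h2
    have h3 : (inner ℝ u (S.φ x u) : ℝ) = 0 := by
      have := S.inner_φ_left x u u
      rw [real_inner_comm] at this
      linarith
    rw [sectionalCurvature, S.inner_φ_φ, S.η_eq_inner, h1, h2, h3] at h
    simpa using h
  rw [← sub_eq_zero]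
  refine eq_zero_of_inner_field fun W hW => ?_
  have h := sasakianSpaceForm_curvature_algebra (S.φ x).toLinearMap (S.ξ x) c R hadd hsmul hanti
    hpair hbianchi (S.φ_sq' x) (S.inner_φ_left x) (S.inner_ξ_ξ x) (S.φ_ξ x) hRξ hRφ hsec u v (W x)
    hu hv
  simp only [inner_sub_left, inner_add_left, real_inner_smul_left]
  simp only [hR, ContinuousLinearMap.coe_coe] at h
  rw [h]
  ring

end ContactMetricStructure
end SasakianIdentities

/-! ### Covariant differentiation along a curve. -/

section AlongCurves
variable {d : ℕ} {N : Type*} [TopologicalSpace N] [ChartedSpace (EuclideanSpace ℝ (Fin d)) N]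
  [IsManifold (𝓡 d) ∞ N] {X Y Z W : ∀ x : N, TangentSpace (𝓡 d) x}
  {nabla : CovariantDerivative (𝓡 d) (EuclideanSpace ℝ (Fin d))
      (fun x : N => TangentSpace (𝓡 d) x)}
  {γ : ℝ → N} {J : Set ℝ} {s : ℝ}

theorem extend_eq_symmL {x : N} (v : TangentSpace (𝓡 d) x) {y : N}
    (hy : y ∈ (trivializationAt (EuclideanSpace ℝ (Fin d)) (fun x : N => TangentSpace (𝓡 d) x)
      x).baseSet) :
    FiberBundle.extend (E := fun x : N => TangentSpace (𝓡 d) x) (EuclideanSpace ℝ (Fin d)) v y =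
      (trivializationAt (EuclideanSpace ℝ (Fin d)) (fun x : N => TangentSpace (𝓡 d) x) x).symmL ℝ y
        ((trivializationAt (EuclideanSpace ℝ (Fin d)) (fun x : N => TangentSpace (𝓡 d) x)
          x).continuousLinearMapAt ℝ x v) := by
  set e := trivializationAt (EuclideanSpace ℝ (Fin d)) (fun x : N => TangentSpace (𝓡 d) x) x
  have hx : x ∈ e.baseSet := FiberBundle.mem_baseSet_trivializationAt' x
  have h : e.continuousLinearMapAt ℝ x v = (e ⟨x, v⟩).2 := by
    rw [Trivialization.continuousLinearMapAt_apply, Trivialization.coe_linearMapAt_of_mem e hx]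
  rw [e.symmL_apply hy, h]
  rfl

theorem eventually_mem_baseSet (x : N) : ∀ᶠ y in 𝓝 x, y ∈ (trivializationAt
    (EuclideanSpace ℝ (Fin d)) (fun x : N => TangentSpace (𝓡 d) x) x).baseSet :=
  (trivializationAt (EuclideanSpace ℝ (Fin d)) (fun x : N => TangentSpace (𝓡 d) x)
    x).open_baseSet.mem_nhds (FiberBundle.mem_baseSet_trivializationAt' x)

theorem mdifferentiableAt_extend {x : N} (v : TangentSpace (𝓡 d) x) :
    MDifferentiableAt (𝓡 d) (𝓡 d).tangent
      (fun y : N => (⟨y, FiberBundle.extend (E := fun x : N => TangentSpace (𝓡 d) x)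
        (EuclideanSpace ℝ (Fin d)) v y⟩ : TangentBundle (𝓡 d) N)) x :=
  FiberBundle.mdifferentiableAt_extend (𝓡 d) (EuclideanSpace ℝ (Fin d)) v

theorem nabla_sum {ι : Type*} (A : Finset ι) {x : N} (σ : ι → ∀ x : N, TangentSpace (𝓡 d) x)
    (hσ : ∀ i, MDifferentiableAt (𝓡 d) (𝓡 d).tangent
      (fun y : N => (⟨y, σ i y⟩ : TangentBundle (𝓡 d) N)) x) :
    nabla (∑ i ∈ A, σ i) x = ∑ i ∈ A, nabla (σ i) x := by
  classical
  induction A using Finset.induction_on with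
  | empty => simp
  | insert a A ha ih =>
    rw [Finset.sum_insert ha, Finset.sum_insert ha,
      nabla.isCovariantDerivativeOnUniv.add (hσ a), ih]
    have := MDifferentiableAt.sum_section (I := 𝓡 d) (F := EuclideanSpace ℝ (Fin d))
      (E := fun x : N => TangentSpace (𝓡 d) x) (s := A) (t := σ) (x₀ := x) (fun i _ => hσ i)
    convert this using 3
    simp

/-- Near `x` the extension is linear in the vector, being constant in the chart frame, so the
coefficients contribute no derivative. -/
theorem nabla_extend_sum {ι : Type*} (A : Finset ι) {x : N} (a : ι → ℝ)
    (v : ι → TangentSpace (𝓡 d) x) :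
    nabla (FiberBundle.extend (EuclideanSpace ℝ (Fin d)) (∑ i ∈ A, a i • v i)) x =
      ∑ i ∈ A, a i • nabla (FiberBundle.extend (EuclideanSpace ℝ (Fin d)) (v i)) x := by
  have hd : ∀ i, MDifferentiableAt (𝓡 d) (𝓡 d).tangent (fun y : N => (⟨y, (a i •
      FiberBundle.extend (E := fun x : N => TangentSpace (𝓡 d) x) (EuclideanSpace ℝ (Fin d))
        (v i)) y⟩ : TangentBundle (𝓡 d) N)) x := fun i =>
    MDifferentiableAt.smul_const_section (mdifferentiableAt_extend (v i))
  have he : ∀ᶠ y in 𝓝 x, FiberBundle.extend (E := fun x : N => TangentSpace (𝓡 d) x)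
      (EuclideanSpace ℝ (Fin d)) (∑ i ∈ A, a i • v i) y = (∑ i ∈ A, a i • FiberBundle.extend
        (E := fun x : N => TangentSpace (𝓡 d) x) (EuclideanSpace ℝ (Fin d)) (v i)) y := by
    filter_upwards [eventually_mem_baseSet (d := d) x] with y hy
    simp only [Finset.sum_apply, Pi.smul_apply]
    simp only [extend_eq_symmL _ hy, map_sum, map_smul]
  rw [nabla.isCovariantDerivativeOnUniv.congr_of_eventuallyEq (mdifferentiableAt_extend _) ?_
    Filter.univ_mem he, nabla_sum _ _ hd]
  · refine Finset.sum_congr rfl fun i _ => ?_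
    exact nabla.isCovariantDerivativeOnUniv.smul_const (a i) (mdifferentiableAt_extend (v i))
  · refine (mdifferentiableAt_extend (∑ i ∈ A, a i • v i)).congr_of_eventuallyEq ?_
    exact he.mono fun y hy => by dsimp only; rw [hy]

omit [IsManifold (𝓡 d) ∞ N] in
theorem hasDerivAt_comp_curve {F : Type*} [NormedAddCommGroup F] [NormedSpace ℝ F] {f : N → F}
    (hf : MDifferentiableAt (𝓡 d) 𝓘(ℝ, F) f (γ s))
    (hγ : MDifferentiableAt 𝓘(ℝ, ℝ) (𝓡 d) γ s) :
    HasDerivAt (fun t => f (γ t)) (mvfderiv (𝓡 d) f (γ s) (velocity γ s)) s := by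
  have h := hf.hasMFDerivAt.comp s hγ.hasMFDerivAt
  have h' : HasFDerivAt (fun t => f (γ t)) ((mvfderiv (𝓡 d) f (γ s)).comp
    (mfderiv 𝓘(ℝ, ℝ) (𝓡 d) γ s) : ℝ →L[ℝ] F) s := hasMFDerivAt_iff_hasFDerivAt.mp h
  exact h'.hasDerivAt

/-- The coordinates of a vector field in the trivialization at `x`. -/
def fieldCoord (x : N) (X : ∀ x : N, TangentSpace (𝓡 d) x) (y : N) : EuclideanSpace ℝ (Fin d) :=
  (trivializationAt (EuclideanSpace ℝ (Fin d)) (fun x : N => TangentSpace (𝓡 d) x) x ⟨y, X y⟩).2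

theorem mdifferentiableAt_fieldCoord (hX : IsSmoothVectorField X) (x : N) :
    MDifferentiableAt (𝓡 d) 𝓘(ℝ, EuclideanSpace ℝ (Fin d)) (fieldCoord x X) x :=
  (_root_.mdifferentiableAt_section (𝓡 d) X).mp (hX.mdifferentiableAt x)

/-- A connection in the coordinate frame of the chart at `x`. -/
theorem nabla_apply_eq_fieldCoord (hX : IsSmoothVectorField X) (x : N)
    (u : TangentSpace (𝓡 d) x) :
    nabla X x u = (trivializationAt (EuclideanSpace ℝ (Fin d))
        (fun x : N => TangentSpace (𝓡 d) x) x).symmL ℝ x (mvfderiv (𝓡 d) (fieldCoord x X) x u)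
      + nabla (FiberBundle.extend (EuclideanSpace ℝ (Fin d)) (X x)) x u := by
  set e := trivializationAt (EuclideanSpace ℝ (Fin d)) (fun x : N => TangentSpace (𝓡 d) x) x
    with he
  have hx : x ∈ e.baseSet := FiberBundle.mem_baseSet_trivializationAt' x
  set b : Fin d → EuclideanSpace ℝ (Fin d) := fun k => EuclideanSpace.single k 1 with hb
  have hsum : ∀ w : EuclideanSpace ℝ (Fin d), w = ∑ k, EuclideanSpace.proj (𝕜 := ℝ) k w • b k := by
    intro w
    have := ((EuclideanSpace.basisFun (Fin d) ℝ).sum_repr w).symm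
    simpa [hb] using this
  set f : Fin d → N → ℝ := fun k y => EuclideanSpace.proj (𝕜 := ℝ) k (fieldCoord x X y) with hf
  -- `p k` is the coordinate frame of the chart and `f k` are the components of `X` in it. The
  -- Leibniz rule splits each summand into the derivative of its component and a term with frozen
  -- coefficient.
  set p : Fin d → ∀ x : N, TangentSpace (𝓡 d) x := fun k =>
    FiberBundle.extend (EuclideanSpace ℝ (Fin d)) (e.symmL ℝ x (b k)) with hp
  have hpe : ∀ k, ∀ y ∈ e.baseSet, p k y = e.symmL ℝ y (b k) := by
    intro k y hy
    simp only [hp]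
    rw [extend_eq_symmL _ hy, e.continuousLinearMapAt_symmL hx]
  have hX' : ∀ y ∈ e.baseSet, X y = ∑ k, f k y • p k y := by
    intro y hy
    have h1 : X y = e.symmL ℝ y (fieldCoord x X y) := by
      have := e.symmL_continuousLinearMapAt (R := ℝ) hy (X y)
      rw [Trivialization.continuousLinearMapAt_apply,
        Trivialization.coe_linearMapAt_of_mem e hy] at this
      exact this.symm
    rw [h1]
    conv_lhs => rw [hsum (fieldCoord x X y)]
    simp only [map_sum, map_smul, fun k => hpe k y hy, hf]
  have hp_diff : ∀ k, MDifferentiableAt (𝓡 d) (𝓡 d).tangent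
      (fun y : N => (⟨y, p k y⟩ : TangentBundle (𝓡 d) N)) x := fun k =>
    mdifferentiableAt_extend _
  have hf_deriv : ∀ k, HasMFDerivAt (𝓡 d) 𝓘(ℝ, ℝ) (f k) x
      ((EuclideanSpace.proj (𝕜 := ℝ) k).comp (mvfderiv (𝓡 d) (fieldCoord x X) x)) := fun k =>
    (ContinuousLinearMap.hasMFDerivAt (EuclideanSpace.proj (𝕜 := ℝ) k)).comp x
      (mdifferentiableAt_fieldCoord hX x).hasMFDerivAt
  have hfp : ∀ k, MDifferentiableAt (𝓡 d) (𝓡 d).tangent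
      (fun y : N => (⟨y, (f k • p k) y⟩ : TangentBundle (𝓡 d) N)) x := fun k =>
    MDifferentiableAt.smul_section (hf_deriv k).mdifferentiableAt (hp_diff k)
  have h1 : nabla X x = nabla (∑ k, f k • p k) x := by
    refine nabla.isCovariantDerivativeOnUniv.congr_of_eventuallyEq (hX.mdifferentiableAt x) ?_
      Filter.univ_mem ?_
    · refine (hX.mdifferentiableAt x).congr_of_eventuallyEq ?_
      filter_upwards [e.open_baseSet.mem_nhds hx] with y hy
      rw [hX' y hy]
      simp
    · filter_upwards [e.open_baseSet.mem_nhds hx] with y hy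
      rw [hX' y hy]
      simp
  have h2 : nabla (FiberBundle.extend (EuclideanSpace ℝ (Fin d)) (X x)) x
      = ∑ k, f k x • nabla (p k) x := by
    rw [hX' x hx, nabla_extend_sum]
    refine Finset.sum_congr rfl fun k _ => ?_
    simp only [hpe k x hx]
    rfl
  rw [h1, nabla_sum _ _ hfp, h2]
  conv_rhs => rw [hsum (mvfderiv (𝓡 d) (fieldCoord x X) x u)]
  simp only [map_sum, map_smul, sum_apply, ← Finset.sum_add_distrib]
  refine Finset.sum_congr rfl fun k _ => ?_
  rw [nabla.isCovariantDerivativeOnUniv.leibniz (hp_diff k) (hf_deriv k).mdifferentiableAt]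
  rw [add_comm]
  simp only [add_apply, ContinuousLinearMap.smulRight_apply, hpe k x hx]
  congr 2
  have := congrArg (fun L => L u) (hf_deriv k).mfderiv
  exact this

theorem clmAt_field {x y : N} (hy : y ∈ (trivializationAt
    (EuclideanSpace ℝ (Fin d)) (fun x : N => TangentSpace (𝓡 d) x) x).baseSet)
    (u : TangentSpace (𝓡 d) y) : (trivializationAt
    (EuclideanSpace ℝ (Fin d)) (fun x : N => TangentSpace (𝓡 d) x) x).continuousLinearMapAt ℝ y u
      = (trivializationAt (EuclideanSpace ℝ (Fin d)) (fun x : N => TangentSpace (𝓡 d) x) x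
        ⟨y, u⟩).2 := by
  rw [Trivialization.continuousLinearMapAt_apply, Trivialization.coe_linearMapAt_of_mem _ hy]

/-- The covariant derivative along `γ` of a combination of vector fields of `N`. -/
theorem covDerivAlong_of_eventuallyEq_sum {ι : Type*} [Fintype ι]
    {V : ∀ s, TangentSpace (𝓡 d) (γ s)} {v : ι → ℝ → ℝ} {v' : ι → ℝ}
    {X : ι → ∀ x : N, TangentSpace (𝓡 d) x}
    (hγ : MDifferentiableAt 𝓘(ℝ, ℝ) (𝓡 d) γ s) (hX : ∀ i, IsSmoothVectorField (X i))
    (hv : ∀ i, HasDerivAt (v i) (v' i) s) (hV : ∀ᶠ t in 𝓝 s, V t = ∑ i, v i t • X i (γ t)) :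
    covDerivAlong nabla γ V s =
      ∑ i, (v' i • X i (γ s) + v i s • nabla (X i) (γ s) (velocity γ s)) := by
  set e := trivializationAt (EuclideanSpace ℝ (Fin d)) (fun x : N => TangentSpace (𝓡 d) x) (γ s)
    with he
  have hx : γ s ∈ e.baseSet := FiberBundle.mem_baseSet_trivializationAt' (γ s)
  have hcoord : (fun t => (e ⟨γ t, V t⟩).2)
      =ᶠ[𝓝 s] fun t => ∑ i, v i t • fieldCoord (γ s) (X i) (γ t) := by
    filter_upwards [hV, hγ.continuousAt.eventually (eventually_mem_baseSet (d := d) (γ s))]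
      with t ht hb
    have := clmAt_field hb (V t)
    rw [← this, ht, map_sum]
    refine Finset.sum_congr rfl fun i _ => ?_
    rw [map_smul, clmAt_field hb]
    rfl
  have hderiv : HasDerivAt (fun t => ∑ i, v i t • fieldCoord (γ s) (X i) (γ t))
      (∑ i, (v i s • mvfderiv (𝓡 d) (fieldCoord (γ s) (X i)) (γ s) (velocity γ s)
        + v' i • fieldCoord (γ s) (X i) (γ s))) s :=
    HasDerivAt.fun_sum fun i _ =>
      (hv i).smul (hasDerivAt_comp_curve (mdifferentiableAt_fieldCoord (hX i) (γ s)) hγ)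
  rw [covDerivAlong, (hderiv.congr_of_eventuallyEq hcoord).deriv, hV.self_of_nhds, nabla_extend_sum,
    ← e.symmL_apply (R := ℝ) hx]
  simp only [map_sum, map_add, map_smul, sum_apply, ← Finset.sum_add_distrib, smul_apply]
  refine Finset.sum_congr rfl fun i _ => ?_
  have h1 : e.symmL ℝ (γ s) (fieldCoord (γ s) (X i) (γ s)) = X i (γ s) := by
    have := e.symmL_continuousLinearMapAt (R := ℝ) hx (X i (γ s))
    rwa [clmAt_field hx] at this
  rw [h1, nabla_apply_eq_fieldCoord (hX i)]
  module

/-- Every field along the curve is locally a combination of restricted ambient fields, namely the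
chart frame cut off by bump functions. This reduces differentiation along `γ` to scalar coefficients
and the ambient connection. -/
theorem exists_sum_field [T2Space N] {V : ∀ s, TangentSpace (𝓡 d) (γ s)}
    (hV : IsSmoothAlong γ J V) (hJ : IsOpen J) (hs : s ∈ J) :
    ∃ (v : Fin d → ℝ → ℝ) (X : Fin d → ∀ x : N, TangentSpace (𝓡 d) x),
      (∀ i, IsSmoothVectorField (X i)) ∧ (∀ i, DifferentiableAt ℝ (v i) s) ∧
      ∀ᶠ t in 𝓝 s, V t = ∑ i, v i t • X i (γ t) := by
  set e := trivializationAt (EuclideanSpace ℝ (Fin d)) (fun x : N => TangentSpace (𝓡 d) x) (γ s)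
    with he
  have hx : γ s ∈ e.baseSet := FiberBundle.mem_baseSet_trivializationAt' (γ s)
  set b : Fin d → EuclideanSpace ℝ (Fin d) := fun k => EuclideanSpace.single k 1 with hb
  have hsum : ∀ w : EuclideanSpace ℝ (Fin d), w = ∑ k, EuclideanSpace.proj (𝕜 := ℝ) k w • b k := by
    intro w
    have := ((EuclideanSpace.basisFun (Fin d) ℝ).sum_repr w).symm
    simpa [hb] using this
  choose X hX hXe using fun k => exists_smooth_extension (e.symmL ℝ (γ s) (b k))
  have hVs := contMDiffAt_totalSpace.mp ((hV s hs).contMDiffAt (hJ.mem_nhds hs))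
  have hV2 : DifferentiableAt ℝ (fun t => (e ⟨γ t, V t⟩).2) s :=
    hVs.2.contDiffAt.differentiableAt (by simp)
  refine ⟨fun k t => EuclideanSpace.proj (𝕜 := ℝ) k (e ⟨γ t, V t⟩).2, X, hX, fun k => ?_, ?_⟩
  · exact (EuclideanSpace.proj (𝕜 := ℝ) k).differentiableAt.comp s hV2
  · have hγ : ContinuousAt γ s := hVs.1.continuousAt
    filter_upwards [hγ.eventually (eventually_mem_baseSet (d := d) (γ s)),
      hγ.eventually (Filter.eventually_all.mpr hXe)] with t ht hXt
    have h1 : V t = e.symmL ℝ (γ t) (e ⟨γ t, V t⟩).2 := by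
      have := e.symmL_continuousLinearMapAt (R := ℝ) ht (V t)
      rw [clmAt_field ht] at this
      exact this.symm
    conv_lhs => rw [h1, hsum (e ⟨γ t, V t⟩).2]
    rw [map_sum]
    refine Finset.sum_congr rfl fun k _ => ?_
    rw [map_smul, hXt k, extend_eq_symmL _ ht, e.continuousLinearMapAt_symmL hx]

theorem covDerivAlong_congr {V W : ∀ s, TangentSpace (𝓡 d) (γ s)}
    (h : ∀ᶠ t in 𝓝 s, V t = W t) : covDerivAlong nabla γ V s = covDerivAlong nabla γ W s := by
  have h1 : (fun t => (trivializationAt (EuclideanSpace ℝ (Fin d))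
        (fun x : N => TangentSpace (𝓡 d) x) (γ s) ⟨γ t, V t⟩).2) =ᶠ[𝓝 s]
      (fun t => (trivializationAt (EuclideanSpace ℝ (Fin d))
        (fun x : N => TangentSpace (𝓡 d) x) (γ s) ⟨γ t, W t⟩).2) := by
    filter_upwards [h] with t ht
    rw [ht]
  rw [covDerivAlong, covDerivAlong, h1.deriv_eq, h.self_of_nhds]

/-- The covariant derivative along `γ` of a combination of vector fields along `γ`. -/
theorem covDerivAlong_sum [T2Space N] {ι : Type*} [Fintype ι]
    {V : ι → ∀ s, TangentSpace (𝓡 d) (γ s)} {f : ι → ℝ → ℝ} {f' : ι → ℝ}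
    (hγ : MDifferentiableAt 𝓘(ℝ, ℝ) (𝓡 d) γ s) (hV : ∀ i, IsSmoothAlong γ J (V i)) (hJ : IsOpen J)
    (hs : s ∈ J) (hf : ∀ i, HasDerivAt (f i) (f' i) s) :
    covDerivAlong nabla γ (fun t => ∑ i, f i t • V i t) s =
      ∑ i, (f' i • V i s + f i s • covDerivAlong nabla γ (V i) s) := by
  choose v X hX hv hVe using fun i => exists_sum_field (hV i) hJ hs
  have h1 : ∀ᶠ t in 𝓝 s, ∑ i, f i t • V i t
      = ∑ p : ι × Fin d, (f p.1 t * v p.1 p.2 t) • X p.1 p.2 (γ t) := by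
    filter_upwards [Filter.eventually_all.mpr hVe] with t ht
    rw [Fintype.sum_prod_type]
    refine Finset.sum_congr rfl fun i _ => ?_
    rw [ht i, Finset.smul_sum]
    simp only [smul_smul]
  rw [covDerivAlong_of_eventuallyEq_sum hγ (fun p : ι × Fin d => hX p.1 p.2)
    (fun p => (hf p.1).mul (hv p.1 p.2).hasDerivAt) h1, Fintype.sum_prod_type]
  refine Finset.sum_congr rfl fun i _ => ?_
  rw [covDerivAlong_of_eventuallyEq_sum hγ (hX i) (fun k => (hv i k).hasDerivAt) (hVe i),
    (hVe i).self_of_nhds, Finset.smul_sum, Finset.smul_sum, ← Finset.sum_add_distrib]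
  refine Finset.sum_congr rfl fun k _ => ?_
  simp only [Pi.mul_apply]
  module

theorem covDerivAlong_comp (hγ : MDifferentiableAt 𝓘(ℝ, ℝ) (𝓡 d) γ s)
    (hX : IsSmoothVectorField X) :
    covDerivAlong nabla γ (fun t => X (γ t)) s = nabla X (γ s) (velocity γ s) := by
  rw [covDerivAlong_of_eventuallyEq_sum (ι := Unit) (v := fun _ _ => 1) (v' := fun _ => 0)
    (X := fun _ => X) hγ (fun _ => hX) (fun _ => hasDerivAt_const s 1)
    (Filter.Eventually.of_forall fun t => by simp)]
  simp

theorem isSmoothAlong_comp (hγ : ContMDiffOn 𝓘(ℝ, ℝ) (𝓡 d) ∞ γ J)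
    (hX : IsSmoothVectorField X) : IsSmoothAlong γ J (fun t => X (γ t)) :=
  ContMDiff.comp_contMDiffOn hX hγ

section Metric
variable [RiemannianBundle (fun x : N => TangentSpace (𝓡 d) x)]
  [IsContMDiffRiemannianBundle (𝓡 d) ∞ (EuclideanSpace ℝ (Fin d))
      (fun x : N => TangentSpace (𝓡 d) x)]

theorem IsLeviCivita.hasDerivAt_inner_along [T2Space N] (hn : IsLeviCivita nabla)
    {V W : ∀ s, TangentSpace (𝓡 d) (γ s)} (hV : IsSmoothAlong γ J V) (hW : IsSmoothAlong γ J W)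
    (hJ : IsOpen J) (hs : s ∈ J) (hγ : MDifferentiableAt 𝓘(ℝ, ℝ) (𝓡 d) γ s) :
    HasDerivAt (fun t => (inner ℝ (V t) (W t) : ℝ))
      (inner ℝ (covDerivAlong nabla γ V s) (W s)
        + inner ℝ (V s) (covDerivAlong nabla γ W s)) s := by
  obtain ⟨v, X, hX, hv, hVe⟩ := exists_sum_field hV hJ hs
  obtain ⟨w, Y, hY, hw, hWe⟩ := exists_sum_field hW hJ hs
  -- Ambient metric compatibility is stated for a direction field, so the velocity at `s` is
  -- extended to one.
  obtain ⟨T, hT, hTs⟩ := exists_smooth_field_eq (velocity (d := d) γ s)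
  have h1 : (fun t => (inner ℝ (V t) (W t) : ℝ)) =ᶠ[𝓝 s]
      fun t => ∑ i, ∑ j, (v i t * w j t) * inner ℝ (X i (γ t)) (Y j (γ t)) := by
    filter_upwards [hVe, hWe] with t h1 h2
    rw [h1, h2, sum_inner]
    refine Finset.sum_congr rfl fun i _ => ?_
    rw [inner_sum]
    refine Finset.sum_congr rfl fun j _ => ?_
    rw [real_inner_smul_left, real_inner_smul_right]
    ring
  refine HasDerivAt.congr_of_eventuallyEq ?_ h1
  have h2 : ∀ i j, HasDerivAt (fun t => (inner ℝ (X i (γ t)) (Y j (γ t)) : ℝ))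
      (inner ℝ (nabla (X i) (γ s) (velocity γ s)) (Y j (γ s))
        + inner ℝ (X i (γ s)) (nabla (Y j) (γ s) (velocity γ s))) s := by
    intro i j
    have h3 := hasDerivAt_comp_curve
      ((((hX i).inner (hY j)) (γ s)).mdifferentiableAt (n := ∞) (by simp)) hγ
    rw [← hTs, hn.mvfderiv_inner (hX i) (hY j)] at h3
    rw [← hTs]
    exact h3
  have h3 := HasDerivAt.fun_sum (u := Finset.univ) fun i _ =>
    HasDerivAt.fun_sum (u := Finset.univ) fun j _ =>
      ((hv i).hasDerivAt.mul (hw j).hasDerivAt).mul (h2 i j)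
  convert! h3 using 1
  rw [covDerivAlong_of_eventuallyEq_sum hγ hX (fun i => (hv i).hasDerivAt) hVe,
    covDerivAlong_of_eventuallyEq_sum hγ hY (fun i => (hw i).hasDerivAt) hWe,
    hVe.self_of_nhds, hWe.self_of_nhds, sum_inner, sum_inner, ← Finset.sum_add_distrib]
  refine Finset.sum_congr rfl fun i _ => ?_
  rw [inner_sum, inner_sum, ← Finset.sum_add_distrib]
  refine Finset.sum_congr rfl fun j _ => ?_
  simp only [inner_add_left, inner_add_right, real_inner_smul_left, real_inner_smul_right,
    Pi.mul_apply]
  ring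

end Metric
end AlongCurves

/-! ### The Sasakian identities along a curve. -/

section SasakianAlongCurves
variable {n : ℕ} {N : Type*} [TopologicalSpace N] [T2Space N]
  [ChartedSpace (EuclideanSpace ℝ (Fin (2 * n + 1))) N] [IsManifold (𝓡 (2 * n + 1)) ∞ N]
  [RiemannianBundle (fun x : N => TangentSpace (𝓡 (2 * n + 1)) x)]
  [IsContMDiffRiemannianBundle (𝓡 (2 * n + 1)) ∞
  (EuclideanSpace ℝ (Fin (2 * n + 1))) (fun x : N => TangentSpace (𝓡 (2 * n + 1)) x)]
  {nabla : CovariantDerivative (𝓡 (2 * n + 1)) (EuclideanSpace ℝ (Fin (2 * n + 1)))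
      (fun x : N => TangentSpace (𝓡 (2 * n + 1)) x)}
  {S : ContactMetricStructure n N} {γ : ℝ → N} {J : Set ℝ} {s : ℝ}
  {V : ∀ s, TangentSpace (𝓡 (2 * n + 1)) (γ s)}

namespace ContactMetricStructure

omit [T2Space N] [IsContMDiffRiemannianBundle (𝓡 (2 * n + 1)) ∞
  (EuclideanSpace ℝ (Fin (2 * n + 1))) (fun x : N => TangentSpace (𝓡 (2 * n + 1)) x)] in
theorem isSmoothAlong_φ (hV : IsSmoothAlong γ J V)
    (hγ : ContMDiffOn 𝓘(ℝ, ℝ) (𝓡 (2 * n + 1)) ∞ γ J) :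
    IsSmoothAlong γ J (fun t => S.φ (γ t) (V t)) :=
  ContMDiffOn.clm_bundle_apply (S.smooth_φ.comp_contMDiffOn hγ) hV

theorem IsSasakian.covDerivAlong_φ (hS : S.IsSasakian) (hn : IsLeviCivita nabla)
    (hV : IsSmoothAlong γ J V) (hJ : IsOpen J) (hs : s ∈ J)
    (hγ : MDifferentiableAt 𝓘(ℝ, ℝ) (𝓡 (2 * n + 1)) γ s) :
    covDerivAlong nabla γ (fun t => S.φ (γ t) (V t)) s = S.φ (γ s) (covDerivAlong nabla γ V s)
      + (inner ℝ (velocity γ s) (V s) : ℝ) • S.ξ (γ s) - S.η (γ s) (V s) • velocity γ s := by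
  obtain ⟨v, X, hX, hv, hVe⟩ := exists_sum_field hV hJ hs
  obtain ⟨T, hT, hTs⟩ := exists_smooth_field_eq (velocity (d := 2 * n + 1) γ s)
  have h1 : ∀ᶠ t in 𝓝 s, S.φ (γ t) (V t) = ∑ i, v i t • S.φField (X i) (γ t) := by
    filter_upwards [hVe] with t ht
    rw [ht, map_sum]
    simp only [map_smul, φField]
  rw [covDerivAlong_of_eventuallyEq_sum hγ (fun i => S.isSmooth_φField (hX i))
    (fun i => (hv i).hasDerivAt) h1,
    covDerivAlong_of_eventuallyEq_sum hγ hX (fun i => (hv i).hasDerivAt) hVe, hVe.self_of_nhds,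
    map_sum, map_sum, inner_sum, Finset.sum_smul, Finset.sum_smul, ← Finset.sum_add_distrib,
    ← Finset.sum_sub_distrib]
  refine Finset.sum_congr rfl fun i _ => ?_
  have h2 := hS.covDerivφ_eq hn hT (hX i) (γ s)
  simp only [covDerivφ, covDeriv] at h2
  rw [hTs, sub_eq_iff_eq_add] at h2
  rw [h2, map_add, map_smul, map_smul, map_smul, S.η_eq_inner, real_inner_smul_right]
  simp only [φField, smul_eq_mul]
  module

/-- Here $\eta=g(\cdot,\xi)$, and $\nabla_T\xi=-\varphi T$ produces the second term. -/
theorem IsSasakian.hasDerivAt_η (hS : S.IsSasakian) (hn : IsLeviCivita nabla)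
    (hV : IsSmoothAlong γ J V) (hJ : IsOpen J) (hs : s ∈ J)
    (hγ : ContMDiffOn 𝓘(ℝ, ℝ) (𝓡 (2 * n + 1)) ∞ γ J) :
    HasDerivAt (fun t => S.η (γ t) (V t)) (S.η (γ s) (covDerivAlong nabla γ V s)
      - inner ℝ (V s) (S.φ (γ s) (velocity γ s))) s := by
  have hγs : MDifferentiableAt 𝓘(ℝ, ℝ) (𝓡 (2 * n + 1)) γ s :=
    ((hγ s hs).contMDiffAt (hJ.mem_nhds hs)).mdifferentiableAt (by simp)
  obtain ⟨T, hT, hTs⟩ := exists_smooth_field_eq (velocity (d := 2 * n + 1) γ s)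
  have h1 := hn.hasDerivAt_inner_along hV (isSmoothAlong_comp hγ S.smooth_ξ) hJ hs hγs
  have h2 := hS.covDeriv_ξ hn hT (γ s)
  simp only [covDeriv] at h2
  rw [covDerivAlong_comp hγs S.smooth_ξ, ← hTs, h2, inner_neg_right, ← S.η_eq_inner,
    ← sub_eq_add_neg] at h1
  simp only [S.η_eq_inner] at h1 ⊢
  rwa [← hTs]

end ContactMetricStructure
end SasakianAlongCurves

/-! ### Solution of the polynomial system. -/

/-- The closed forms of the curvatures and `φ`-torsions, from the algebraic relations between
`k i = κ i`, `a = τ₁₂`, `b = τ₁₄`, `t = τ₂₃`, `u = τ₃₄` and `e = η (E 3)`. -/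
theorem closed_forms_of_relations {c k₁ k₂ k₃ a b t u e ε : ℝ} (hk₁ : 0 < k₁) (hk₂ : 0 < k₂)
    (hk₃ : 0 < k₃) (hε : ε = 1 ∨ ε = -1) (ha : 0 < -ε * a) (hab : a ^ 2 + b ^ 2 = 1)
    (h₁ : k₁ ^ 2 + k₂ ^ 2 = (c + 3) / 4 + 3 * (c - 1) / 4 * a ^ 2)
    (h₂ : k₂ * k₃ = -(3 * (c - 1) / 4) * a * b) (h₃ : k₂ * e = -a) (h₄ : k₃ * e = b)
    (h₅ : k₁ ^ 2 + 1 = k₁ ^ 2 * a ^ 2 + (k₃ * b - k₂ * a) ^ 2)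
    (h₆ : -k₁ * t + e = k₃ * b - k₂ * a) (h₇ : a * t = b * u) :
    c ∈ Set.Ioo (7 / 3 : ℝ) 5 ∧
      (k₁ = √(c + 3) / 2 ∧ k₂ = 1 / 2 * √(6 * (c - 1) * (5 - c) / (c + 3)) ∧
        k₃ = 1 / 2 * √(3 * (c - 1) * (3 * c - 7) / (c + 3))) ∧
      a = -ε * √(2 * (5 - c) / (c + 3)) ∧ b = ε * √((3 * c - 7) / (c + 3)) ∧
      t = -ε * ((3 * c - 7) / √(3 * (c - 1) * (c + 3))) ∧
      u = ε * √(2 * (5 - c) * (3 * c - 7) / (3 * (c - 1) * (c + 3))) := by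
  have hε2 : ε * ε = 1 := by rcases hε with rfl | rfl <;> norm_num
  -- The sign is absorbed into all five unknowns so that each new one turns out positive, as needed
  -- to extract square roots.
  obtain ⟨p, rfl⟩ : ∃ p, a = -ε * p := ⟨-ε * a, by linear_combination -a * hε2⟩
  obtain ⟨q, rfl⟩ : ∃ q, b = ε * q := ⟨ε * b, by linear_combination -b * hε2⟩
  obtain ⟨e', rfl⟩ : ∃ q, e = ε * q := ⟨ε * e, by linear_combination -e * hε2⟩
  obtain ⟨t', rfl⟩ : ∃ q, t = -ε * q := ⟨-ε * t, by linear_combination -t * hε2⟩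
  obtain ⟨u', rfl⟩ : ∃ q, u = ε * q := ⟨ε * u, by linear_combination -u * hε2⟩
  have hp : 0 < p := by linear_combination ha + p * hε2
  have hpq : p ^ 2 + q ^ 2 = 1 := by linear_combination hab - (p ^ 2 + q ^ 2) * hε2
  replace h₁ : k₁ ^ 2 + k₂ ^ 2 = (c + 3) / 4 + 3 * (c - 1) / 4 * p ^ 2 := by
    linear_combination h₁ + 3 * (c - 1) / 4 * p ^ 2 * hε2
  replace h₂ : k₂ * k₃ = 3 * (c - 1) / 4 * p * q := by
    linear_combination h₂ + 3 * (c - 1) / 4 * p * q * hε2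
  replace h₃ : k₂ * e' = p := by linear_combination ε * h₃ - (k₂ * e' - p) * hε2
  replace h₄ : k₃ * e' = q := by linear_combination ε * h₄ - (k₃ * e' - q) * hε2
  replace h₅ : k₁ ^ 2 + 1 = k₁ ^ 2 * p ^ 2 + (k₃ * q + k₂ * p) ^ 2 := by
    linear_combination h₅ + (k₁ ^ 2 * p ^ 2 + (k₃ * q + k₂ * p) ^ 2) * hε2
  replace h₆ : k₁ * t' + e' = k₃ * q + k₂ * p := by
    linear_combination ε * h₆ - (k₁ * t' + e' - k₃ * q - k₂ * p) * hε2
  replace h₇ : p * t' = q * u' := by linear_combination h₇ - (p * t' - q * u') * hε2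
  have he : 0 < e' := by
    by_contra h
    nlinarith
  have hq : 0 < q := h₄ ▸ mul_pos hk₃ he
  -- Eliminating `e'` gives `k₂ : k₃ = p : q`, so the product relation `h₂` splits into separate
  -- values of `k₂ ^ 2` and `k₃ ^ 2`; `h₁` then leaves `k₁ ^ 2`.
  have h8 : k₂ ^ 2 = 3 * (c - 1) / 4 * p ^ 2 := by
    refine mul_right_cancel₀ hq.ne' ?_
    linear_combination p * h₂ + k₂ ^ 2 * (-h₄) + k₂ * k₃ * h₃
  have h9 : k₃ ^ 2 = 3 * (c - 1) / 4 * q ^ 2 := by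
    refine mul_right_cancel₀ hp.ne' ?_
    linear_combination q * h₂ + k₃ ^ 2 * (-h₃) + k₂ * k₃ * h₄
  have h10 : k₁ ^ 2 = (c + 3) / 4 := by linarith
  have h11 : (k₃ * q + k₂ * p) ^ 2 = 3 * (c - 1) / 4 := by
    have : (k₃ * q + k₂ * p) ^ 2
        = k₃ ^ 2 * q ^ 2 + 2 * (k₂ * k₃) * (p * q) + k₂ ^ 2 * p ^ 2 := by ring
    rw [this, h8, h9, h₂]
    linear_combination 3 * (c - 1) / 4 * (p ^ 2 + q ^ 2 + 1) * hpq
  have hc3 : 0 < c + 3 := by nlinarith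
  -- The norm relation is now linear in `p ^ 2` and fixes `p` and `q` in terms of `c`. Their
  -- positivity is exactly the bound on `c`.
  have h12 : (c + 3) * q ^ 2 = 3 * c - 7 := by
    rw [h11, h10] at h₅
    linear_combination (c + 3) * hpq + 4 * h₅
  have h13 : (c + 3) * p ^ 2 = 2 * (5 - c) := by linear_combination (c + 3) * hpq - h12
  have hc7 : 0 < 3 * c - 7 := by rw [← h12]; positivity
  have hc5 : 0 < 5 - c := by
    have : 0 < (c + 3) * p ^ 2 := by positivity
    linarith
  have hc1 : 0 < c - 1 := by linarith
  have hq2 : q ^ 2 = (3 * c - 7) / (c + 3) := by rw [← h12]; field_simp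
  have hp2 : p ^ 2 = 2 * (5 - c) / (c + 3) := by rw [← h13]; field_simp
  have h14 : k₁ * k₂ * t' = p * ((3 * c - 7) / 4) := by
    refine mul_right_cancel₀ hp.ne' ?_
    linear_combination k₂ * p * h₆ - p * h₃ + p * q * h₂ + p ^ 2 * h8
      + 3 * (c - 1) / 4 * p ^ 2 * hpq
  have ht : 0 < t' := by
    have : 0 < k₁ * k₂ * t' := h14 ▸ by positivity
    exact (mul_pos_iff_of_pos_left (by positivity)).mp this
  have hu : 0 < u' := by
    have : 0 < q * u' := h₇ ▸ by positivity
    exact (mul_pos_iff_of_pos_left hq).mp this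
  have ht2 : t' ^ 2 * (3 * (c - 1) * (c + 3)) = (3 * c - 7) ^ 2 := by
    have : (k₁ * k₂ * t') ^ 2 = k₁ ^ 2 * k₂ ^ 2 * t' ^ 2 := by ring
    rw [h14, h10, h8] at this
    refine mul_right_cancel₀ (pow_pos hp 2).ne' ?_
    linear_combination -16 * this
  refine ⟨⟨by linarith, by linarith⟩, ⟨?_, ?_, ?_⟩, ?_, ?_, ?_, ?_⟩
  · have : c + 3 = (2 * k₁) ^ 2 := by linarith
    rw [this, Real.sqrt_sq (by positivity)]
    ring
  · have : 6 * (c - 1) * (5 - c) / (c + 3) = (2 * k₂) ^ 2 := by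
      rw [mul_pow, h8, hp2]
      ring
    rw [this, Real.sqrt_sq (by positivity)]
    ring
  · have : 3 * (c - 1) * (3 * c - 7) / (c + 3) = (2 * k₃) ^ 2 := by
      rw [mul_pow, h9, hq2]
      ring
    rw [this, Real.sqrt_sq (by positivity)]
    ring
  · rw [← hp2, Real.sqrt_sq hp.le]
  · rw [← hq2, Real.sqrt_sq hq.le]
  · congr 1
    rw [eq_div_iff (by positivity), ← Real.sqrt_sq ht.le, ← Real.sqrt_mul (by positivity), ht2,
      Real.sqrt_sq hc7.le]
  · have : 2 * (5 - c) * (3 * c - 7) / (3 * (c - 1) * (c + 3)) = u' ^ 2 := by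
      rw [div_eq_iff (by positivity), ← h13]
      refine mul_right_cancel₀ (pow_pos hq 2).ne' ?_
      have h15 : (p * t') ^ 2 = (q * u') ^ 2 := by rw [h₇]
      linear_combination (3 * c - 7) * p ^ 2 * h12 - p ^ 2 * ht2
        + (3 * (c - 1) * (c + 3)) * h15
    rw [this, Real.sqrt_sq hu.le]

/-! ### Frenet calculus in osculating order four. -/

section FrenetOrderFour
variable {d : ℕ} {N : Type*} [TopologicalSpace N] [ChartedSpace (EuclideanSpace ℝ (Fin d)) N]
  [IsManifold (𝓡 d) ∞ N]
  {nabla : CovariantDerivative (𝓡 d) (EuclideanSpace ℝ (Fin d))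
      (fun x : N => TangentSpace (𝓡 d) x)}
  [RiemannianBundle (fun x : N => TangentSpace (𝓡 d) x)]
  {γ : ℝ → N} {J : Set ℝ} {s : ℝ} {E : ℕ → ∀ s, TangentSpace (𝓡 d) (γ s)} {κ : ℕ → ℝ → ℝ}

namespace IsFrenetCurve

theorem mdifferentiableAt (hF : IsFrenetCurve nabla γ J 4 E κ) (hJ : IsOpen J) (hs : s ∈ J) :
    MDifferentiableAt 𝓘(ℝ, ℝ) (𝓡 d) γ s :=
  ((hF.smooth_curve s hs).contMDiffAt (hJ.mem_nhds hs)).mdifferentiableAt (by simp)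

theorem covDerivAlong_one (hF : IsFrenetCurve nabla γ J 4 E κ) (hs : s ∈ J) :
    covDerivAlong nabla γ (E 1) s = κ 1 s • E 2 s := by
  simpa using hF.frenet s hs 1 (by decide)

theorem covDerivAlong_two (hF : IsFrenetCurve nabla γ J 4 E κ) (hs : s ∈ J) :
    covDerivAlong nabla γ (E 2) s = -κ 1 s • E 1 s + κ 2 s • E 3 s := by
  simpa using hF.frenet s hs 2 (by decide)

theorem covDerivAlong_three (hF : IsFrenetCurve nabla γ J 4 E κ) (hs : s ∈ J) :
    covDerivAlong nabla γ (E 3) s = -κ 2 s • E 2 s + κ 3 s • E 4 s := by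
  simpa using hF.frenet s hs 3 (by decide)

theorem covDerivAlong_four (hF : IsFrenetCurve nabla γ J 4 E κ) (hs : s ∈ J) :
    covDerivAlong nabla γ (E 4) s = -κ 3 s • E 3 s := by
  simpa using hF.frenet s hs 4 (by decide)

/-- The covariant derivative of a field given by its components in the Frenet frame. -/
theorem covDerivAlong_frame [T2Space N] (hF : IsFrenetCurve nabla γ J 4 E κ) (hJ : IsOpen J)
    (hs : s ∈ J) {V : ∀ s, TangentSpace (𝓡 d) (γ s)} {f₁ f₂ f₃ f₄ : ℝ → ℝ} {a₁ a₂ a₃ a₄ : ℝ}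
    (hV : ∀ t ∈ J, V t = f₁ t • E 1 t + f₂ t • E 2 t + f₃ t • E 3 t + f₄ t • E 4 t)
    (h₁ : HasDerivAt f₁ a₁ s) (h₂ : HasDerivAt f₂ a₂ s) (h₃ : HasDerivAt f₃ a₃ s)
    (h₄ : HasDerivAt f₄ a₄ s) :
    covDerivAlong nabla γ V s = (a₁ - κ 1 s * f₂ s) • E 1 s
      + (a₂ + κ 1 s * f₁ s - κ 2 s * f₃ s) • E 2 s
      + (a₃ + κ 2 s * f₂ s - κ 3 s * f₄ s) • E 3 s + (a₄ + κ 3 s * f₃ s) • E 4 s := by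
  -- The shift `i + 1` matches `Fin 4` with a frame numbered from 1.
  rw [covDerivAlong_congr (W := fun t => ∑ i : Fin 4, (![f₁, f₂, f₃, f₄] i) t • E (i + 1) t)
    (by filter_upwards [hJ.mem_nhds hs] with t ht
        rw [hV t ht]
        simp [Fin.sum_univ_four]),
    covDerivAlong_sum (V := fun i : Fin 4 => E (i + 1)) (f := ![f₁, f₂, f₃, f₄])
      (f' := ![a₁, a₂, a₃, a₄]) (hF.mdifferentiableAt hJ hs)
      (fun i => hF.smooth_frame _ (by fin_cases i <;> decide)) hJ hs
      (by intro i; fin_cases i <;> assumption)]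
  simp only [Fin.sum_univ_four, Matrix.cons_val,
    Fin.coe_ofNat_eq_mod, Nat.reduceMod, Nat.reduceAdd, hF.covDerivAlong_one hs,
    hF.covDerivAlong_two hs, hF.covDerivAlong_three hs, hF.covDerivAlong_four hs]
  module

theorem hasDerivAt_curvature (hF : IsFrenetCurve nabla γ J 4 E κ) (hJ : IsOpen J) (hs : s ∈ J)
    {i : ℕ} (hi : i ∈ Finset.Ico 1 4) : HasDerivAt (κ i) (deriv (κ i) s) s :=
  (((hF.smooth_curvature i hi).contDiffAt (hJ.mem_nhds hs)).differentiableAt (by simp)).hasDerivAt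

theorem hasDerivAt_deriv_curvature (hF : IsFrenetCurve nabla γ J 4 E κ) (hJ : IsOpen J)
    (hs : s ∈ J) {i : ℕ} (hi : i ∈ Finset.Ico 1 4) :
    HasDerivAt (deriv (κ i)) (deriv (deriv (κ i)) s) s :=
  (((contDiffOn_infty_iff_deriv_of_isOpen hJ).mp (hF.smooth_curvature i hi)).2.contDiffAt
    (hJ.mem_nhds hs)).differentiableAt (by simp) |>.hasDerivAt

theorem tension_eq (hF : IsFrenetCurve nabla γ J 4 E κ) (hJ : IsOpen J) (hs : s ∈ J) :
    tension nabla γ s = κ 1 s • E 2 s := by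
  rw [tension, ← hF.covDerivAlong_one hs]
  refine covDerivAlong_congr ?_
  filter_upwards [hJ.mem_nhds hs] with t ht
  exact (hF.frame_one t ht).symm

theorem covDerivAlong_tension [T2Space N] (hF : IsFrenetCurve nabla γ J 4 E κ) (hJ : IsOpen J)
    (hs : s ∈ J) : covDerivAlong nabla γ (tension nabla γ) s =
      -(κ 1 s) ^ 2 • E 1 s + deriv (κ 1) s • E 2 s + (κ 1 s * κ 2 s) • E 3 s := by
  rw [hF.covDerivAlong_frame hJ hs (f₁ := 0) (f₃ := 0) (f₄ := 0)
    (fun t ht => by simpa using hF.tension_eq hJ ht) (hasDerivAt_const s 0)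
    (hF.hasDerivAt_curvature hJ hs (by decide)) (hasDerivAt_const s 0) (hasDerivAt_const s 0)]
  simp only [Pi.zero_apply]
  module

theorem covDerivAlong_covDerivAlong_tension [T2Space N] (hF : IsFrenetCurve nabla γ J 4 E κ)
    (hJ : IsOpen J) (hs : s ∈ J) :
    covDerivAlong nabla γ (covDerivAlong nabla γ (tension nabla γ)) s =
      (-3 * κ 1 s * deriv (κ 1) s) • E 1 s
      + (deriv (deriv (κ 1)) s - κ 1 s ^ 3 - κ 1 s * κ 2 s ^ 2) • E 2 s
      + (2 * deriv (κ 1) s * κ 2 s + κ 1 s * deriv (κ 2) s) • E 3 s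
      + (κ 1 s * κ 2 s * κ 3 s) • E 4 s := by
  have h₁ := hF.hasDerivAt_curvature hJ hs (i := 1) (by decide)
  have h₂ := hF.hasDerivAt_curvature hJ hs (i := 2) (by decide)
  rw [hF.covDerivAlong_frame hJ hs (f₁ := fun t => -(κ 1 t) ^ 2) (f₂ := deriv (κ 1))
    (f₃ := fun t => κ 1 t * κ 2 t) (f₄ := fun _ => 0)
    (fun t ht => by simpa using hF.covDerivAlong_tension hJ ht) (h₁.pow 2).neg
    (hF.hasDerivAt_deriv_curvature hJ hs (by decide)) (h₁.mul h₂) (hasDerivAt_const s 0)]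
  push_cast
  simp only [pow_one]
  module

end IsFrenetCurve
end FrenetOrderFour

/-! ### The biharmonic equation for Legendre curves. -/

section LegendreFrenetOrderFour
variable {n : ℕ} {N : Type*} [TopologicalSpace N] [T2Space N]
  [ChartedSpace (EuclideanSpace ℝ (Fin (2 * n + 1))) N] [IsManifold (𝓡 (2 * n + 1)) ∞ N]
  [RiemannianBundle (fun x : N => TangentSpace (𝓡 (2 * n + 1)) x)]
  [IsContMDiffRiemannianBundle (𝓡 (2 * n + 1)) ∞
  (EuclideanSpace ℝ (Fin (2 * n + 1))) (fun x : N => TangentSpace (𝓡 (2 * n + 1)) x)]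
  {nabla : CovariantDerivative (𝓡 (2 * n + 1)) (EuclideanSpace ℝ (Fin (2 * n + 1)))
      (fun x : N => TangentSpace (𝓡 (2 * n + 1)) x)}
  {S : ContactMetricStructure n N} {γ : ℝ → N} {J : Set ℝ} {s c : ℝ}
  {E : ℕ → ∀ s, TangentSpace (𝓡 (2 * n + 1)) (γ s)} {κ : ℕ → ℝ → ℝ}

namespace ContactMetricStructure

omit [IsContMDiffRiemannianBundle (𝓡 (2 * n + 1)) ∞
  (EuclideanSpace ℝ (Fin (2 * n + 1))) (fun x : N => TangentSpace (𝓡 (2 * n + 1)) x)]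

theorem inner_φ_self (x : N) (u : TangentSpace (𝓡 (2 * n + 1)) x) :
    (inner ℝ u (S.φ x u) : ℝ) = 0 := by
  have h := S.inner_φ_left x u u
  rw [real_inner_comm] at h
  linarith

theorem inner_φ_comm (x : N) (u v : TangentSpace (𝓡 (2 * n + 1)) x) :
    (inner ℝ u (S.φ x v) : ℝ) = -inner ℝ v (S.φ x u) := by
  rw [← S.inner_φ_left, real_inner_comm]

end ContactMetricStructure

omit [T2Space N] [IsContMDiffRiemannianBundle (𝓡 (2 * n + 1)) ∞
  (EuclideanSpace ℝ (Fin (2 * n + 1))) (fun x : N => TangentSpace (𝓡 (2 * n + 1)) x)] in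
theorem η_frame_one (hF : IsFrenetCurve nabla γ J 4 E κ) (hL : S.IsLegendreOn γ J)
    (hs : s ∈ J) : S.η (γ s) (E 1 s) = 0 := by
  rw [hF.frame_one s hs]
  exact hL s hs

variable (hF : IsFrenetCurve nabla γ J 4 E κ) (hJ : IsOpen J) (hL : S.IsLegendreOn γ J)
  (hn : IsLeviCivita nabla)
include hF hJ hL hn

omit hL in
-- Once $\eta(E_i)$ is known on all of $J$, differentiating it and inserting the Frenet equation
-- yields $\eta$ of the next frame vector.
theorem η_covDerivAlong_of_eqOn (hS : S.IsSasakian) {i : ℕ} (hi : i ∈ Finset.Icc 1 4)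
    {f : ℝ → ℝ} (hf : ∀ t ∈ J, S.η (γ t) (E i t) = f t) {f' : ℝ} (hs : s ∈ J)
    (hf' : HasDerivAt f f' s) :
    S.η (γ s) (covDerivAlong nabla γ (E i) s) = f' + inner ℝ (E i s) (S.φ (γ s) (E 1 s)) := by
  have h := hS.hasDerivAt_η hn (hF.smooth_frame i hi) hJ hs hF.smooth_curve
  have h' : HasDerivAt (fun t => S.η (γ t) (E i t)) f' s := by
    refine hf'.congr_of_eventuallyEq ?_
    filter_upwards [hJ.mem_nhds hs] with t ht using hf t ht
  rw [hF.frame_one s hs, ← h.unique h']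
  ring

theorem η_frame_two (hS : S.IsSasakian) (hs : s ∈ J) : S.η (γ s) (E 2 s) = 0 := by
  have h := η_covDerivAlong_of_eqOn hF hJ hn hS (i := 1) (by decide) (f := fun _ => 0)
    (fun t ht => η_frame_one hF hL ht) hs (hasDerivAt_const s 0)
  rw [hF.covDerivAlong_one hs, map_smul, S.inner_φ_self, add_zero, smul_eq_mul] at h
  exact (mul_eq_zero.mp h).resolve_left (hF.curvature_pos 1 (by decide) s hs).ne'

/-- The extra term is $(\nabla_T\varphi)T=\xi$, since $T$ is a horizontal unit vector. -/
theorem covDerivAlong_φ_frame_one (hS : S.IsSasakian) (hs : s ∈ J) :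
    covDerivAlong nabla γ (fun t => S.φ (γ t) (E 1 t)) s =
      κ 1 s • S.φ (γ s) (E 2 s) + S.ξ (γ s) := by
  have h1 := hF.orthonormal s hs 1 (by decide) 1 (by decide)
  rw [hS.covDerivAlong_φ hn (hF.smooth_frame 1 (by decide)) hJ hs (hF.mdifferentiableAt hJ hs),
    hF.covDerivAlong_one hs, map_smul, ← hF.frame_one s hs, h1, η_frame_one hF hL hs]
  simp

theorem hasDerivAt_inner_φ_frame_one (hS : S.IsSasakian) {i : ℕ} (hi : i ∈ Finset.Icc 1 4)
    (hs : s ∈ J) : HasDerivAt (fun t => (inner ℝ (E i t) (S.φ (γ t) (E 1 t)) : ℝ))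
      (inner ℝ (covDerivAlong nabla γ (E i) s) (S.φ (γ s) (E 1 s))
        + κ 1 s * inner ℝ (E i s) (S.φ (γ s) (E 2 s)) + S.η (γ s) (E i s)) s := by
  have h := hn.hasDerivAt_inner_along (hF.smooth_frame i hi)
    (S.isSmoothAlong_φ (hF.smooth_frame 1 (by decide)) hF.smooth_curve) hJ hs
    (hF.mdifferentiableAt hJ hs)
  rw [covDerivAlong_φ_frame_one hF hJ hL hn hS hs, inner_add_right, real_inner_smul_right,
    ← S.η_eq_inner, ← add_assoc] at h
  exact h

/-- The bitension field of a Legendre curve in the Frenet frame. -/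
theorem bitension_eq (hS : S.IsSasakianSpaceForm nabla c) (hs : s ∈ J) :
    bitension nabla γ s = (-3 * κ 1 s * deriv (κ 1) s) • E 1 s
      + (deriv (deriv (κ 1)) s - κ 1 s ^ 3 - κ 1 s * κ 2 s ^ 2 + (c + 3) / 4 * κ 1 s) • E 2 s
      + (2 * deriv (κ 1) s * κ 2 s + κ 1 s * deriv (κ 2) s) • E 3 s
      + (κ 1 s * κ 2 s * κ 3 s) • E 4 s
      + (3 * (c - 1) / 4 * κ 1 s * inner ℝ (E 2 s) (S.φ (γ s) (E 1 s))) • S.φ (γ s) (E 1 s) := by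
  have h1 := hF.orthonormal s hs 1 (by decide) 1 (by decide)
  have h2 := hF.orthonormal s hs 1 (by decide) 2 (by decide)
  rw [bitension, hF.covDerivAlong_covDerivAlong_tension hJ hs, ← hF.frame_one s hs,
    hF.tension_eq hJ hs, hS.curvature_eq hn _ _ _ (η_frame_one hF hL hs)
      (by rw [map_smul, η_frame_two hF hJ hL hn hS.1 hs, smul_zero]),
    map_smul, real_inner_smul_right, real_inner_smul_right, S.inner_φ_comm _ (E 1 s), h1, h2]
  simp only [if_true]
  rw [if_neg (by decide)]
  module

omit [T2Space N] [IsContMDiffRiemannianBundle (𝓡 (2 * n + 1)) ∞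
  (EuclideanSpace ℝ (Fin (2 * n + 1))) (fun x : N => TangentSpace (𝓡 (2 * n + 1)) x)] hJ hn in
theorem inner_φ_φ_frame_one (hs : s ∈ J) :
    (inner ℝ (S.φ (γ s) (E 1 s)) (S.φ (γ s) (E 1 s)) : ℝ) = 1 := by
  rw [S.inner_φ_φ, η_frame_one hF hL hs, hF.orthonormal s hs 1 (by decide) 1 (by decide)]
  simp

/-- The biharmonic equation in the Frenet frame. -/
theorem frame_relations_of_biharmonic (hS : S.IsSasakianSpaceForm nabla c)
    (hB : IsBiharmonicOn nabla γ J) (hs : s ∈ J) :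
    κ 1 s ^ 2 + κ 2 s ^ 2 = (c + 3) / 4
      + 3 * (c - 1) / 4 * (inner ℝ (E 2 s) (S.φ (γ s) (E 1 s)) : ℝ) ^ 2 ∧
    deriv (κ 1) s = 0 ∧
    deriv (κ 2) s = -(3 * (c - 1) / 4) * inner ℝ (E 2 s) (S.φ (γ s) (E 1 s))
      * inner ℝ (E 3 s) (S.φ (γ s) (E 1 s)) ∧
    κ 2 s * κ 3 s = -(3 * (c - 1) / 4) * inner ℝ (E 2 s) (S.φ (γ s) (E 1 s))
      * inner ℝ (E 4 s) (S.φ (γ s) (E 1 s)) ∧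
    S.φ (γ s) (E 1 s) = (inner ℝ (E 2 s) (S.φ (γ s) (E 1 s)) : ℝ) • E 2 s
      + (inner ℝ (E 3 s) (S.φ (γ s) (E 1 s)) : ℝ) • E 3 s
      + (inner ℝ (E 4 s) (S.φ (γ s) (E 1 s)) : ℝ) • E 4 s := by
  have ho := hF.orthonormal s hs
  have k1 := hF.curvature_pos 1 (by decide) s hs
  have k2 := hF.curvature_pos 2 (by decide) s hs
  have k3 := hF.curvature_pos 3 (by decide) s hs
  have key : ∀ t ∈ J, ∀ i ∈ Finset.Icc 1 4, (inner ℝ (E i t) (bitension nabla γ t) : ℝ) = 0 :=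
    fun t ht i _ => by rw [hB t ht, inner_zero_right]
  -- The `E 1` component is needed on all of `J`, so that the second derivative of `κ 1` vanishes as
  -- well.
  have hd : ∀ t ∈ J, deriv (κ 1) t = 0 := by
    intro t ht
    have h := key t ht 1 (by decide)
    have ho := hF.orthonormal t ht
    rw [bitension_eq hF hJ hL hn hS ht] at h
    simp only [inner_add_right, real_inner_smul_right, S.inner_φ_self,
      ho 1 (by decide) 1 (by decide), ho 1 (by decide) 2 (by decide),
      ho 1 (by decide) 3 (by decide), ho 1 (by decide) 4 (by decide)] at h
    norm_num at h
    exact h.resolve_left (hF.curvature_pos 1 (by decide) t ht).ne'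
  have hd1 := hd s hs
  have hd2 : deriv (deriv (κ 1)) s = 0 := by
    have : deriv (κ 1) =ᶠ[𝓝 s] fun _ => 0 := by
      filter_upwards [hJ.mem_nhds hs] with t ht using hd t ht
    rw [this.deriv_eq, deriv_const]
  have h2 := key s hs 2 (by decide)
  have h3 := key s hs 3 (by decide)
  have h4 := key s hs 4 (by decide)
  have hb := hB s hs
  rw [bitension_eq hF hJ hL hn hS hs, hd1, hd2] at h2 h3 h4 hb
  simp only [inner_add_right, real_inner_smul_right, ho 2 (by decide) 1 (by decide),
    ho 2 (by decide) 2 (by decide), ho 2 (by decide) 3 (by decide),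
    ho 2 (by decide) 4 (by decide), ho 3 (by decide) 1 (by decide),
    ho 3 (by decide) 2 (by decide), ho 3 (by decide) 3 (by decide),
    ho 3 (by decide) 4 (by decide), ho 4 (by decide) 1 (by decide),
    ho 4 (by decide) 2 (by decide), ho 4 (by decide) 3 (by decide),
    ho 4 (by decide) 4 (by decide)] at h2 h3 h4
  norm_num at h2 h3 h4
  set f2 := (inner ℝ (E 2 s) (S.φ (γ s) (E 1 s)) : ℝ)
  set f3 := (inner ℝ (E 3 s) (S.φ (γ s) (E 1 s)) : ℝ)
  set f4 := (inner ℝ (E 4 s) (S.φ (γ s) (E 1 s)) : ℝ)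
  have r2 : κ 1 s ^ 2 + κ 2 s ^ 2 = (c + 3) / 4 + 3 * (c - 1) / 4 * f2 ^ 2 :=
    mul_left_cancel₀ k1.ne' (by linear_combination -h2)
  have r3 : deriv (κ 2) s = -(3 * (c - 1) / 4) * f2 * f3 :=
    mul_left_cancel₀ k1.ne' (by linear_combination h3)
  have r4 : κ 2 s * κ 3 s = -(3 * (c - 1) / 4) * f2 * f4 :=
    mul_left_cancel₀ k1.ne' (by linear_combination h4)
  -- This is the coefficient of `φ (E 1)` in the bitension field. It is nonzero because `κ 2 * κ 3`
  -- is, so the equation can be solved for `φ (E 1)` in terms of the frame.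
  have hne : 3 * (c - 1) / 4 * κ 1 s * f2 ≠ 0 := by
    intro h
    have : κ 1 s * (κ 2 s * κ 3 s) = 0 := by rw [r4]; linear_combination -f4 * h
    exact (by positivity : κ 1 s * (κ 2 s * κ 3 s) ≠ 0) this
  refine ⟨r2, hd1, r3, r4, ?_⟩
  refine smul_right_injective _ hne ?_
  dsimp only
  rw [← sub_eq_zero, ← hb]
  match_scalars
  · ring
  · linear_combination κ 1 s * r2
  · linear_combination -κ 1 s * r3
  · linear_combination -κ 1 s * r4
  · ring

end LegendreFrenetOrderFour

/-! ### Constancy of the invariants and the torsion relations. -/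

section BiharmonicLegendreOrderFour
variable {n : ℕ} {N : Type*} [TopologicalSpace N] [T2Space N]
  [ChartedSpace (EuclideanSpace ℝ (Fin (2 * n + 1))) N] [IsManifold (𝓡 (2 * n + 1)) ∞ N]
  [RiemannianBundle (fun x : N => TangentSpace (𝓡 (2 * n + 1)) x)]
  [IsContMDiffRiemannianBundle (𝓡 (2 * n + 1)) ∞
  (EuclideanSpace ℝ (Fin (2 * n + 1))) (fun x : N => TangentSpace (𝓡 (2 * n + 1)) x)]
  {nabla : CovariantDerivative (𝓡 (2 * n + 1)) (EuclideanSpace ℝ (Fin (2 * n + 1)))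
      (fun x : N => TangentSpace (𝓡 (2 * n + 1)) x)}
  {S : ContactMetricStructure n N} {γ : ℝ → N} {J : Set ℝ} {s c : ℝ}
  {E : ℕ → ∀ s, TangentSpace (𝓡 (2 * n + 1)) (γ s)} {κ : ℕ → ℝ → ℝ}
  (hF : IsFrenetCurve nabla γ J 4 E κ) (hJ : IsOpen J) (hL : S.IsLegendreOn γ J)
  (hn : IsLeviCivita nabla) (hS : S.IsSasakianSpaceForm nabla c) (hB : IsBiharmonicOn nabla γ J)
include hF hJ hL hn hS hB

omit hB in
theorem hasDerivAt_inner_frame_two_φ (hs : s ∈ J) :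
    HasDerivAt (fun t => (inner ℝ (E 2 t) (S.φ (γ t) (E 1 t)) : ℝ))
      (κ 2 s * inner ℝ (E 3 s) (S.φ (γ s) (E 1 s))) s := by
  have h := hasDerivAt_inner_φ_frame_one hF hJ hL hn hS.1 (i := 2) (by decide) hs
  rw [η_frame_two hF hJ hL hn hS.1 hs, S.inner_φ_self, hF.covDerivAlong_two hs, inner_add_left,
    real_inner_smul_left, real_inner_smul_left, S.inner_φ_self] at h
  simpa using h

theorem inner_frame_two_φ_ne_zero (hs : s ∈ J) :
    (inner ℝ (E 2 s) (S.φ (γ s) (E 1 s)) : ℝ) ≠ 0 := by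
  intro h
  have h4 := (frame_relations_of_biharmonic hF hJ hL hn hS hB hs).2.2.2.1
  rw [h, mul_zero, zero_mul] at h4
  exact (mul_pos (hF.curvature_pos 2 (by decide) s hs)
    (hF.curvature_pos 3 (by decide) s hs)).ne' h4

/-- Differentiating $\kappa_1^2+\kappa_2^2=\frac{c+3}4+\frac{3(c-1)}4f_2^2$ with $f_2'=\kappa_2f_3$
gives $\kappa_2'$ the sign opposite to the $E_3$ component of the biharmonic equation, so
$(c-1)\kappa_2f_2f_3=0$. -/
theorem inner_frame_three_φ (hs : s ∈ J) : (inner ℝ (E 3 s) (S.φ (γ s) (E 1 s)) : ℝ) = 0 := by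
  obtain ⟨-, h1, h2, -, -⟩ := frame_relations_of_biharmonic hF hJ hL hn hS hB hs
  have k2 := hF.curvature_pos 2 (by decide) s hs
  have hd1 := hF.hasDerivAt_curvature hJ hs (i := 1) (by decide)
  have hd2 := hF.hasDerivAt_curvature hJ hs (i := 2) (by decide)
  have hf := hasDerivAt_inner_frame_two_φ hF hJ hL hn hS hs
  have hl := (hd1.pow 2).add (hd2.pow 2)
  have hr := ((hf.pow 2).const_mul (3 * (c - 1) / 4)).const_add ((c + 3) / 4)
  have he := hl.unique (hr.congr_of_eventuallyEq (by
    filter_upwards [hJ.mem_nhds hs] with t ht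
    exact (frame_relations_of_biharmonic hF hJ hL hn hS hB ht).1))
  have h4 := (frame_relations_of_biharmonic hF hJ hL hn hS hB hs).2.2.2.1
  have k3 := hF.curvature_pos 3 (by decide) s hs
  rw [h1, h2] at he
  push_cast at he
  set f2 := (inner ℝ (E 2 s) (S.φ (γ s) (E 1 s)) : ℝ)
  set f3 := (inner ℝ (E 3 s) (S.φ (γ s) (E 1 s)) : ℝ)
  set f4 := (inner ℝ (E 4 s) (S.φ (γ s) (E 1 s)) : ℝ)
  -- Multiplying by `f4` trades the factor `(c - 1) * f2` for the positive product `κ 2 * κ 3`.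
  have h5 : (κ 2 s * (κ 2 s * κ 3 s)) * f3 = 0 := by
    rw [h4]
    linear_combination f4 / 4 * he
  exact (mul_eq_zero.mp h5).resolve_left (by positivity)

theorem φ_frame_one_eq (hs : s ∈ J) : S.φ (γ s) (E 1 s) =
    (inner ℝ (E 2 s) (S.φ (γ s) (E 1 s)) : ℝ) • E 2 s
      + (inner ℝ (E 4 s) (S.φ (γ s) (E 1 s)) : ℝ) • E 4 s := by
  have h := (frame_relations_of_biharmonic hF hJ hL hn hS hB hs).2.2.2.2
  rwa [inner_frame_three_φ hF hJ hL hn hS hB hs, zero_smul, add_zero] at h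

theorem sq_add_sq_eq_one (hs : s ∈ J) : (inner ℝ (E 2 s) (S.φ (γ s) (E 1 s)) : ℝ) ^ 2
    + (inner ℝ (E 4 s) (S.φ (γ s) (E 1 s)) : ℝ) ^ 2 = 1 := by
  have h := inner_φ_φ_frame_one hF hL hs
  conv_lhs at h =>
    arg 2
    rw [φ_frame_one_eq hF hJ hL hn hS hB hs]
  rw [inner_add_left, real_inner_smul_left, real_inner_smul_left] at h
  linarith

theorem hasDerivAt_inner_frame_two_φ_zero (hs : s ∈ J) :
    HasDerivAt (fun t => (inner ℝ (E 2 t) (S.φ (γ t) (E 1 t)) : ℝ)) 0 s := by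
  have h := hasDerivAt_inner_frame_two_φ hF hJ hL hn hS hs
  rwa [inner_frame_three_φ hF hJ hL hn hS hB hs, mul_zero] at h

/-- The squares $f_2^2+f_4^2=1$ and the constancy of $f_2$ give $f_4f_4'=0$, while $f_4\ne0$ because
$\kappa_2\kappa_3>0$. -/
theorem hasDerivAt_inner_frame_four_φ_zero (hs : s ∈ J) :
    HasDerivAt (fun t => (inner ℝ (E 4 t) (S.φ (γ t) (E 1 t)) : ℝ)) 0 s := by
  have h4 := hasDerivAt_inner_φ_frame_one hF hJ hL hn hS.1 (i := 4) (by decide) hs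
  have h2 := hasDerivAt_inner_frame_two_φ_zero hF hJ hL hn hS hB hs
  have he := ((h2.pow 2).add (h4.pow 2)).unique ((hasDerivAt_const s (1 : ℝ)).congr_of_eventuallyEq
    (by
      filter_upwards [hJ.mem_nhds hs] with t ht
      exact sq_add_sq_eq_one hF hJ hL hn hS hB ht))
  have hne : (inner ℝ (E 4 s) (S.φ (γ s) (E 1 s)) : ℝ) ≠ 0 := by
    intro h
    have h4 := (frame_relations_of_biharmonic hF hJ hL hn hS hB hs).2.2.2.1
    rw [h, mul_zero] at h4
    exact (mul_pos (hF.curvature_pos 2 (by decide) s hs)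
      (hF.curvature_pos 3 (by decide) s hs)).ne' h4
  simp only [mul_zero, zero_add] at he
  have h0 := (mul_eq_zero.mp he).resolve_left (by simpa using hne)
  rwa [h0] at h4

omit hB in
theorem curvature_two_mul_η_frame_three (hs : s ∈ J) :
    κ 2 s * S.η (γ s) (E 3 s) = inner ℝ (E 2 s) (S.φ (γ s) (E 1 s)) := by
  have h := η_covDerivAlong_of_eqOn hF hJ hn hS.1 (i := 2) (by decide) (f := fun _ => 0)
    (fun t ht => η_frame_two hF hJ hL hn hS.1 ht) hs (hasDerivAt_const s 0)
  rw [hF.covDerivAlong_two hs, map_add, map_smul, map_smul, η_frame_one hF hL hs] at h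
  simpa using h

/-- $\eta(E_3)=f_2/\kappa_2$ has zero derivative, so in $\eta(\nabla_TE_3)=f_3=0$ only
$\kappa_3\eta(E_4)$ remains. -/
theorem η_frame_four (hs : s ∈ J) : S.η (γ s) (E 4 s) = 0 := by
  have k2 := hF.curvature_pos 2 (by decide) s hs
  have k3 := hF.curvature_pos 3 (by decide) s hs
  have hd2 := hF.hasDerivAt_curvature hJ hs (i := 2) (by decide)
  have h3 := inner_frame_three_φ hF hJ hL hn hS hB hs
  rw [(frame_relations_of_biharmonic hF hJ hL hn hS hB hs).2.2.1, h3, mul_zero] at hd2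
  have h := η_covDerivAlong_of_eqOn hF hJ hn hS.1 (i := 3) (by decide)
    (f := fun t => inner ℝ (E 2 t) (S.φ (γ t) (E 1 t)) / κ 2 t)
    (fun t ht => by
      rw [eq_div_iff (hF.curvature_pos 2 (by decide) t ht).ne', mul_comm]
      exact curvature_two_mul_η_frame_three hF hJ hL hn hS ht) hs
    ((hasDerivAt_inner_frame_two_φ_zero hF hJ hL hn hS hB hs).div hd2 k2.ne')
  rw [hF.covDerivAlong_three hs, map_add, map_smul, map_smul, η_frame_two hF hJ hL hn hS.1 hs,
    h3] at h
  simpa [k3.ne'] using h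

theorem curvature_three_mul_η_frame_three (hs : s ∈ J) :
    κ 3 s * S.η (γ s) (E 3 s) = -inner ℝ (E 4 s) (S.φ (γ s) (E 1 s)) := by
  have h := η_covDerivAlong_of_eqOn hF hJ hn hS.1 (i := 4) (by decide) (f := fun _ => 0)
    (fun t ht => η_frame_four hF hJ hL hn hS hB ht) hs (hasDerivAt_const s 0)
  rw [hF.covDerivAlong_four hs, map_smul, zero_add, smul_eq_mul] at h
  linarith

/-- Both sides compute $\nabla_T(\varphi T)$: once by the Sasakian rule, once by the Frenet
equations applied to $f_2E_2+f_4E_4$ with constant coefficients. -/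
theorem frame_derivative_φ_frame_one (hs : s ∈ J) :
    κ 1 s • S.φ (γ s) (E 2 s) + S.ξ (γ s) =
      (-κ 1 s * inner ℝ (E 2 s) (S.φ (γ s) (E 1 s))) • E 1 s
      + (κ 2 s * inner ℝ (E 2 s) (S.φ (γ s) (E 1 s))
        - κ 3 s * inner ℝ (E 4 s) (S.φ (γ s) (E 1 s))) • E 3 s := by
  rw [← covDerivAlong_φ_frame_one hF hJ hL hn hS.1 hs, hF.covDerivAlong_frame hJ hs (f₁ := 0)
    (f₂ := fun t => inner ℝ (E 2 t) (S.φ (γ t) (E 1 t))) (f₃ := 0)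
    (f₄ := fun t => inner ℝ (E 4 t) (S.φ (γ t) (E 1 t)))
    (fun t ht => by simpa using φ_frame_one_eq hF hJ hL hn hS hB ht) (hasDerivAt_const s 0)
    (hasDerivAt_inner_frame_two_φ_zero hF hJ hL hn hS hB hs) (hasDerivAt_const s 0)
    (hasDerivAt_inner_frame_four_φ_zero hF hJ hL hn hS hB hs)]
  simp only [Pi.zero_apply]
  module

theorem φTorsion_relations (hs : s ∈ J) {ε : ℝ} (hε : ε = 1 ∨ ε = -1)
    (hpos : 0 < -ε * S.φTorsion γ E 1 2 s) :
    c ∈ Set.Ioo (7 / 3 : ℝ) 5 ∧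
    (κ 1 s = √(c + 3) / 2 ∧
      κ 2 s = 1 / 2 * √(6 * (c - 1) * (5 - c) / (c + 3)) ∧
      κ 3 s = 1 / 2 * √(3 * (c - 1) * (3 * c - 7) / (c + 3))) ∧
      S.φTorsion γ E 1 2 s = -ε * √(2 * (5 - c) / (c + 3)) ∧
      S.φTorsion γ E 1 3 s = 0 ∧
      S.φTorsion γ E 1 4 s = ε * √((3 * c - 7) / (c + 3)) ∧
      S.φTorsion γ E 2 3 s = -ε * ((3 * c - 7) / √(3 * (c - 1) * (c + 3))) ∧
      S.φTorsion γ E 2 4 s = 0 ∧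
      S.φTorsion γ E 3 4 s = ε * √(2 * (5 - c) * (3 * c - 7) / (3 * (c - 1) * (c + 3))) := by
  have ho := hF.orthonormal s hs
  have k1 := hF.curvature_pos 1 (by decide) s hs
  obtain ⟨r1, -, -, r2, -⟩ := frame_relations_of_biharmonic hF hJ hL hn hS hB hs
  have r3 := curvature_two_mul_η_frame_three hF hJ hL hn hS hs
  have r4 := curvature_three_mul_η_frame_three hF hJ hL hn hS hB hs
  have r5 := sq_add_sq_eq_one hF hJ hL hn hS hB hs
  have hD := frame_derivative_φ_frame_one hF hJ hL hn hS hB hs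
  have hp := φ_frame_one_eq hF hJ hL hn hS hB hs
  have h13 := inner_frame_three_φ hF hJ hL hn hS hB hs
  have e1 := η_frame_one hF hL hs
  have e2 := η_frame_two hF hJ hL hn hS.1 hs
  have e4 := η_frame_four hF hJ hL hn hS hB hs
  have hn2 := S.inner_φ_φ (γ s) (E 2 s) (E 2 s)
  have hφφ := S.φ_sq (γ s) (E 1 s)
  have o22 := (ho 2 (by decide) 2 (by decide)).trans (if_pos rfl)
  have o11 := (ho 1 (by decide) 1 (by decide)).trans (if_pos rfl)
  have o13 := (ho 1 (by decide) 3 (by decide)).trans (if_neg (by decide))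
  have o31 := (ho 3 (by decide) 1 (by decide)).trans (if_neg (by decide))
  have o33 := (ho 3 (by decide) 3 (by decide)).trans (if_pos rfl)
  have o41 := (ho 4 (by decide) 1 (by decide)).trans (if_neg (by decide))
  have o43 := (ho 4 (by decide) 3 (by decide)).trans (if_neg (by decide))
  have eφ : S.η (γ s) (S.φ (γ s) (E 2 s)) = 0 := by rw [S.η_eq_inner, S.inner_φ_ξ]
  -- The norm closes the system for the curvatures, the `E 3` component gives the torsion
  -- $\tau_{23}$, and the `E 4` component gives $\tau_{24}=0$. The relation `r9` for $\tau_{34}$ is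
  -- $\varphi^2T=-T$ paired with `E 3`.
  have r6 := congrArg (fun v => (inner ℝ v v : ℝ)) hD
  have r7 := congrArg (fun v => (inner ℝ (E 3 s) v : ℝ)) hD
  have r8 := congrArg (fun v => (inner ℝ (E 4 s) v : ℝ)) hD
  have r9 : (0 : ℝ) = inner ℝ (E 2 s) (S.φ (γ s) (E 1 s)) * inner ℝ (E 3 s) (S.φ (γ s) (E 2 s))
      + inner ℝ (E 4 s) (S.φ (γ s) (E 1 s)) * inner ℝ (E 3 s) (S.φ (γ s) (E 4 s)) := by
    rw [hp, map_add, map_smul, map_smul, e1, zero_smul, add_zero] at hφφ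
    have := congrArg (fun v => (inner ℝ (E 3 s) v : ℝ)) hφφ
    simp only [inner_add_right, real_inner_smul_right, inner_neg_right, o31] at this
    linarith
  simp only [inner_add_left, inner_add_right, real_inner_smul_left, real_inner_smul_right,
    real_inner_comm (S.φ (γ s) (E 2 s)) (S.ξ (γ s)), ← S.η_eq_inner, map_add, map_smul,
    smul_eq_mul, S.η_ξ, eφ, o11, o13, o31, o33, hn2, o22, e2] at r6
  simp only [inner_add_right, real_inner_smul_right, ← S.η_eq_inner, o31, o33, o41, o43, e4]
    at r7 r8
  have c12 := S.inner_φ_comm (γ s) (E 1 s) (E 2 s)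
  have c13 := S.inner_φ_comm (γ s) (E 1 s) (E 3 s)
  have c14 := S.inner_φ_comm (γ s) (E 1 s) (E 4 s)
  have c23 := S.inner_φ_comm (γ s) (E 3 s) (E 2 s)
  have c24 := S.inner_φ_comm (γ s) (E 2 s) (E 4 s)
  simp only [ContactMetricStructure.φTorsion] at hpos ⊢
  have h24 : (inner ℝ (E 4 s) (S.φ (γ s) (E 2 s)) : ℝ) = 0 :=
    (mul_eq_zero.mp (by linarith : κ 1 s * inner ℝ (E 4 s) (S.φ (γ s) (E 2 s)) = 0)).resolve_left
      k1.ne'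
  have g12 : (inner ℝ (E 2 s) (S.φ (γ s) (E 1 s)) : ℝ) = -inner ℝ (E 1 s) (S.φ (γ s) (E 2 s)) := by
    linarith
  have g14 : (inner ℝ (E 4 s) (S.φ (γ s) (E 1 s)) : ℝ) = -inner ℝ (E 1 s) (S.φ (γ s) (E 4 s)) := by
    linarith
  rw [g12] at r1 r2 r3 r5 r6 r7 r9
  rw [g14] at r2 r4 r5 r6 r7 r9
  rw [c23] at r7 r9
  obtain ⟨q1, q2, q3, q4, q5, q6⟩ := closed_forms_of_relations
    (c := c) (b := inner ℝ (E 1 s) (S.φ (γ s) (E 4 s))) (t := inner ℝ (E 2 s) (S.φ (γ s) (E 3 s)))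
    (u := inner ℝ (E 3 s) (S.φ (γ s) (E 4 s))) (e := S.η (γ s) (E 3 s)) k1
    (hF.curvature_pos 2 (by decide) s hs) (hF.curvature_pos 3 (by decide) s hs) hε hpos
    (by linear_combination r5) (by linear_combination r1) (by linear_combination r2)
    (by linear_combination r3) (by linear_combination r4) (by linear_combination r6)
    (by linear_combination r7) (by linear_combination -r9)
  exact ⟨q1, q2, q3, by rw [c13, h13, neg_zero], q4, q5, by rw [c24, h24, neg_zero], q6⟩

end BiharmonicLegendreOrderFour

end SasakianCurves

end

/-! ### The classification theorem. -/

theorem mainTheorem12 (n : ℕ) (N : Type*) [TopologicalSpace N] [T2Space N]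
    [ChartedSpace (EuclideanSpace ℝ (Fin (2 * n + 1))) N] [IsManifold (𝓡 (2 * n + 1)) ∞ N]
    [Bundle.RiemannianBundle (fun x : N => TangentSpace (𝓡 (2 * n + 1)) x)]
    [IsContMDiffRiemannianBundle (𝓡 (2 * n + 1)) ∞ (EuclideanSpace ℝ (Fin (2 * n + 1)))
      (fun x : N => TangentSpace (𝓡 (2 * n + 1)) x)]
    (nabla : CovariantDerivative (𝓡 (2 * n + 1)) (EuclideanSpace ℝ (Fin (2 * n + 1)))
      (fun x : N => TangentSpace (𝓡 (2 * n + 1)) x))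
    (hnabla : IsLeviCivita nabla)
    (S : ContactMetricStructure n N) (c : ℝ) (hS : S.IsSasakianSpaceForm nabla c)
    (J : Set ℝ) (hJ_open : IsOpen J) (hJ_interval : J.OrdConnected)
    (γ : ℝ → N) (E : ℕ → ∀ s, TangentSpace (𝓡 (2 * n + 1)) (γ s)) (κ : ℕ → ℝ → ℝ)
    (hγ_frenet : IsFrenetCurve nabla γ J 4 E κ)
    (hγ_legendre : S.IsLegendreOn γ J)
    (hγ_biharmonic : IsProperBiharmonicOn nabla γ J) :
    c ∈ Set.Ioo (7 / 3 : ℝ) 5 ∧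
    (∀ s ∈ J,
      κ 1 s = √(c + 3) / 2 ∧
      κ 2 s = 1 / 2 * √(6 * (c - 1) * (5 - c) / (c + 3)) ∧
      κ 3 s = 1 / 2 * √(3 * (c - 1) * (3 * c - 7) / (c + 3))) ∧
    ∃ ε : ℝ, (ε = 1 ∨ ε = -1) ∧ ∀ s ∈ J,
      S.φTorsion γ E 1 2 s = -ε * √(2 * (5 - c) / (c + 3)) ∧
      S.φTorsion γ E 1 3 s = 0 ∧
      S.φTorsion γ E 1 4 s = ε * √((3 * c - 7) / (c + 3)) ∧
      S.φTorsion γ E 2 3 s = -ε * ((3 * c - 7) / √(3 * (c - 1) * (c + 3))) ∧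
      S.φTorsion γ E 2 4 s = 0 ∧
      S.φTorsion γ E 3 4 s = ε * √(2 * (5 - c) * (3 * c - 7) / (3 * (c - 1) * (c + 3))) := by
  obtain ⟨hB, hH⟩ := hγ_biharmonic
  -- Failure of harmonicity supplies a point of `J`; on the empty set no condition on `c` could
  -- follow.
  obtain ⟨s₀, hs₀⟩ : J.Nonempty := by
    by_contra h
    exact hH fun s hs => (h ⟨s, hs⟩).elim
  -- Connectedness of the interval is what lets one `ε` serve every point.
  have hconst : ∀ s ∈ J, S.φTorsion γ E 1 2 s = S.φTorsion γ E 1 2 s₀ := by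
    have h0 : ∀ s ∈ J, HasDerivAt (S.φTorsion γ E 1 2) 0 s := by
      intro s hs
      have h := (hasDerivAt_inner_frame_two_φ_zero hγ_frenet hJ_open hγ_legendre hnabla hS hB
        hs).neg
      rw [neg_zero] at h
      refine h.congr_of_eventuallyEq (Filter.Eventually.of_forall fun t => ?_)
      exact S.inner_φ_comm (γ t) (E 1 t) (E 2 t)
    intro s hs
    exact hJ_open.is_const_of_deriv_eq_zero hJ_interval.isPreconnected
      (fun t ht => (h0 t ht).differentiableAt.differentiableWithinAt)
      (fun t ht => (h0 t ht).deriv) hs hs₀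
  have hne : S.φTorsion γ E 1 2 s₀ ≠ 0 := by
    have h := inner_frame_two_φ_ne_zero hγ_frenet hJ_open hγ_legendre hnabla hS hB hs₀
    rw [ContactMetricStructure.φTorsion, S.inner_φ_comm]
    exact neg_ne_zero.mpr h
  obtain ⟨ε, hε, hpos⟩ : ∃ ε : ℝ, (ε = 1 ∨ ε = -1) ∧ 0 < -ε * S.φTorsion γ E 1 2 s₀ := by
    rcases hne.lt_or_gt with h | h
    · exact ⟨1, Or.inl rfl, by linarith⟩
    · exact ⟨-1, Or.inr rfl, by linarith⟩
  have key := fun s (hs : s ∈ J) => φTorsion_relations hγ_frenet hJ_open hγ_legendre hnabla hS hB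
    hs hε (by rwa [hconst s hs])
  exact ⟨(key s₀ hs₀).1, fun s hs => (key s hs).2.1, ε, hε, fun s hs => (key s hs).2.2⟩
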